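/- Let $A,C\in\mathbb R^{n\times n}$, $B,D\in\mathbb R^{n\times m_1}$, $G\in\mathbb R^{n\times m_2}$, let $Q\in\mathbb R^{n\times n}$ be symmetric with $Q\ge 0$, let $R\in\mathbb R^{m_1\times m_1}$ be symmetric with $R>0$, and let $\gamma>0$. For $K\in\mathbb R^{m_1\times n}$, $L\in\mathbb R^{m_2\times n}$ define the generalized Lyapunov operator $$\mathscr L_{[K,L]}(P)=(A-BK+GL)^{\top}P+P(A-BK+GL)+(C-DK)^{\top}P(C-DK),$$ and let $\sigma(\mathscr L_{[K,L]})\subset\mathbb C$ be the set of its eigenvalues on symmetric $n\times n$ matrices with complex entries; $\mathbb C^-$ is the open left half-plane. Put $$\mathscr K^1(P)=(R+D^{\top}PD)^{-1}(B^{\top}P+D^{\top}PC),\qquad \mathscr K^2(P)=\gamma^{-2}G^{\top}P .$$ Assume that $P^*\ge 0$ is a stabilizing solution of the indefinite stochastic algebraic Riccati equation $$A^{\top}P^*+P^*A+C^{\top}P^*C+Q+\gamma^{-2}P^*GG^{\top}P^*-(P^*B+C^{\top}P^*D)(R+D^{\top}P^*D)^{-1}(B^{\top}P^*+D^{\top}P^*C)=0,$$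 that is, $\sigma(\mathscr L_{[\mathscr K^1(P^*),\mathscr K^2(P^*)]})\subset\mathbb C^-$. For $L\in\mathbb R^{m_2\times n}$ consider the equation $$\mathscr L_{[K_L,L]}(P_L)+Q-\gamma^2L^{\top}L+K_L^{\top}RK_L=0,\qquad K_L=\mathscr K^1(P_L). \tag{E$_L$}$$ A positive semidefinite solution $P_L$ of (E$_L$) is called stabilizing if $\sigma(\mathscr L_{[K_L,L]})\subset\mathbb C^-$. Let $\mathcal W$ be the set of all $L$ for which (E$_L$) has exactly one stabilizing solution $P_L$ with $0\le P_L\le P^*$, and for $\zeta>0$ let $\mathcal D_\zeta=\{L\in\mathcal W:\ \mathrm{Tr}(P^*-P_L)\le\zeta\}$. **Theorem.** For every $\zeta>0$ there is $\alpha\in(0,1)$, depending only on $\zeta$ and on the data above, such that for every $L_p^{k-1}\in\mathcal D_\zeta$ the following holds. The equation (E$_L$) with $L=L_p^{k-1}$ has exactly one positive semidefinite stabilizing solution $P^k$; the next gain $L_p^k=\mathscr K^2(P^k)$ again lies in $\mathcal D_\zeta$; and if $P^{k+1}$ is the positive semidefinite stabilizing solution of (E$_L$) with $L=L_p^{k}$,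 then $$\mathrm{Tr}(P^*-P^{k+1})\le\alpha\,\mathrm{Tr}(P^*-P^{k}).$$ Consequently the outer loop converges linearly: if $L_p^0\in\mathcal D_\zeta$ and, for $k\ge1$, $P^k\geq 0$ is the stabilizing solution of (E$_L$) with $L=L_p^{k-1}$ and $L_p^k=\mathscr K^2(P^k)$, then $\mathrm{Tr}(P^*-P^k)\le\alpha^{k-1}\,\mathrm{Tr}(P^*-P^1)$ for all $k\ge1$. -/

import Mathlib

open Matrix

/-- Data of the system `dx = (A x + B u + G v) dt + (C x + D u) dw` with state, control and
disturbance in `ℝⁿ`, `ℝ^{m₁}`, `ℝ^{m₂}`, together with the weights `Q`, `R` and the attenuation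
level `γ` of the cost. -/
structure Plant (n m₁ m₂ : ℕ) where
  A : Matrix (Fin n) (Fin n) ℝ
  B : Matrix (Fin n) (Fin m₁) ℝ
  G : Matrix (Fin n) (Fin m₂) ℝ
  C : Matrix (Fin n) (Fin n) ℝ
  D : Matrix (Fin n) (Fin m₁) ℝ
  Q : Matrix (Fin n) (Fin n) ℝ
  R : Matrix (Fin m₁) (Fin m₁) ℝ
  γ : ℝ

/-- `P ↦ Fᵀ P + P F + Nᵀ P N`. -/
def lyapunovMap {n : ℕ} {S : Type*} [CommRing S] (F N P : Matrix (Fin n) (Fin n) S) :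
    Matrix (Fin n) (Fin n) S :=
  Fᵀ * P + P * F + Nᵀ * P * N

namespace Plant

variable {n m₁ m₂ : ℕ} (S : Plant n m₁ m₂)

/-- Closed-loop drift matrix `A - B K + G L`. -/
def drift (K : Matrix (Fin m₁) (Fin n) ℝ) (L : Matrix (Fin m₂) (Fin n) ℝ) :
    Matrix (Fin n) (Fin n) ℝ :=
  S.A - S.B * K + S.G * L

/-- Closed-loop diffusion matrix `C - D K`. -/
def diffusion (K : Matrix (Fin m₁) (Fin n) ℝ) : Matrix (Fin n) (Fin n) ℝ :=
  S.C - S.D * K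

/-- The generalized Lyapunov operator `𝓛_{[K, L]}`. -/
def lyap (K : Matrix (Fin m₁) (Fin n) ℝ) (L : Matrix (Fin m₂) (Fin n) ℝ)
    (P : Matrix (Fin n) (Fin n) ℝ) : Matrix (Fin n) (Fin n) ℝ :=
  lyapunovMap (S.drift K L) (S.diffusion K) P

/-- The spectrum of `𝓛_{[K, L]}`: its complex eigenvalues, the operator acting on the symmetric
matrices with complex entries. -/
def lyapSpectrum (K : Matrix (Fin m₁) (Fin n) ℝ) (L : Matrix (Fin m₂) (Fin n) ℝ) : Set ℂ :=
  {z | ∃ P : Matrix (Fin n) (Fin n) ℂ, Pᵀ = P ∧ P ≠ 0 ∧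
    lyapunovMap ((S.drift K L).map Complex.ofReal) ((S.diffusion K).map Complex.ofReal) P = z • P}

/-- `σ(𝓛_{[K, L]})` lies in the open left half-plane. -/
def IsStable (K : Matrix (Fin m₁) (Fin n) ℝ) (L : Matrix (Fin m₂) (Fin n) ℝ) : Prop :=
  ∀ z ∈ S.lyapSpectrum K L, z.re < 0

/-- Control gain `(R + Dᵀ P D)⁻¹ (Bᵀ P + Dᵀ P C)`. -/
noncomputable def gainK (P : Matrix (Fin n) (Fin n) ℝ) : Matrix (Fin m₁) (Fin n) ℝ :=
  (S.R + S.Dᵀ * P * S.D)⁻¹ * (S.Bᵀ * P + S.Dᵀ * P * S.C)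

/-- Disturbance gain `γ⁻² Gᵀ P`. -/
noncomputable def gainL (P : Matrix (Fin n) (Fin n) ℝ) : Matrix (Fin m₂) (Fin n) ℝ :=
  (1 / S.γ ^ 2) • (S.Gᵀ * P)

/-- `P` is a positive semidefinite stabilizing solution of the indefinite stochastic algebraic
Riccati equation. -/
def IsIndefiniteSolution (P : Matrix (Fin n) (Fin n) ℝ) : Prop :=
  P.PosSemidef ∧
  S.Aᵀ * P + P * S.A + S.Cᵀ * P * S.C + S.Q + (1 / S.γ ^ 2) • (P * S.G * S.Gᵀ * P)
    - (P * S.B + S.Cᵀ * P * S.D) * (S.R + S.Dᵀ * P * S.D)⁻¹ * (S.Bᵀ * P + S.Dᵀ * P * S.C) = 0 ∧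
  S.IsStable (S.gainK P) (S.gainL P)

/-- For a fixed disturbance gain `L`, `P` is a positive semidefinite stabilizing solution of
`𝓛_{[K, L]}(P) + Q - γ² Lᵀ L + Kᵀ R K = 0`, `K = gainK P`. -/
def IsOuterSolution (L : Matrix (Fin m₂) (Fin n) ℝ) (P : Matrix (Fin n) (Fin n) ℝ) : Prop :=
  P.PosSemidef ∧
  S.lyap (S.gainK P) L P + S.Q - S.γ ^ 2 • (Lᵀ * L) + (S.gainK P)ᵀ * S.R * S.gainK P = 0 ∧
  S.IsStable (S.gainK P) L

/-- The set `𝓦` of the gains `L` for which there is exactly one stabilizing solution `P_L` with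
`0 ≤ P_L ≤ P*`. -/
def admissibleGains (Pstar : Matrix (Fin n) (Fin n) ℝ) : Set (Matrix (Fin m₂) (Fin n) ℝ) :=
  {L | ∃! P, S.IsOuterSolution L P ∧ (Pstar - P).PosSemidef}

/-- The set `𝓓_ζ` of the gains `L ∈ 𝓦` with `Tr (P* - P_L) ≤ ζ`. -/
def gainSublevel (Pstar : Matrix (Fin n) (Fin n) ℝ) (ζ : ℝ) :
    Set (Matrix (Fin m₂) (Fin n) ℝ) :=
  {L | L ∈ S.admissibleGains Pstar ∧
    ∃ P, S.IsOuterSolution L P ∧ (Pstar - P).PosSemidef ∧ (Pstar - P).trace ≤ ζ}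

/-- `P 1, P 2, …` and `L 0, L 1, …` are generated by the outer loop from the initial gain `L 0`:
for `k ≥ 1`, `P k` solves the Riccati equation with gain `L (k - 1)`, and `L k = γ⁻² Gᵀ (P k)`.
The value `P 0` plays no role. -/
def IsOuterLoop (P : ℕ → Matrix (Fin n) (Fin n) ℝ) (L : ℕ → Matrix (Fin m₂) (Fin n) ℝ) : Prop :=
  ∀ k : ℕ, 1 ≤ k → S.IsOuterSolution (L (k - 1)) (P k) ∧ L k = S.gainL (P k)

end Plant

/-! Let `P` and `P'` be consecutive iterates. Completing squares in both gains makes `P` a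
subsolution and `Pstar` a supersolution of the equation for the updated gain, so a stabilizing
solution exists with `P ≤ P' ≤ Pstar` (`exists_next`). Since Tr(P* - P) = Tr(P* - P') + Tr(P' - P),
contraction follows from a uniform estimate Tr(P* - P') ≤ c Tr(P' - P) (`exists_error_bound`).

Subtracting the equations for `Pstar` and `P'` in bilinear form gives a Sylvester-type equation for
`Pstar - P'`, with the loop of `P'` on the left, the loop of `Pstar` on the right, and a source
linear in `P' - P` (`mixed_error_equation`). The right loop is fixed and stable; the left loop is
stable, but with no evident uniform margin. Subtracting `a • 1` from the left drift and adding it to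
the right drift does not change the mixed operator; for small `a` the right loop stays stable, while
the left one gains a fixed margin.

That margin bounds the determinant of the vectorized left operator away from zero, and its adjugate
is continuous on a compact set, so the left Lyapunov solution is uniformly bounded
(`exists_shifted_solution`). A maximum principle for block matrices carries the bounds on the two
Lyapunov solutions over to `Pstar - P'` (`two_mul_trace_le_of_mixed`).

Stability is handled throughout by Lyapunov certificates, equivalent to the spectral condition by
`isStable_iff`. The resulting contraction factor does not even depend on `ζ`. -/

open scoped Kronecker

/-! ### Real quadratic forms, Finsler's lemma, compactness in the semidefinite cone. -/

section QuadraticForms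

variable {ι κ : Type*} [Fintype ι] [Fintype κ]

theorem real_posSemidef_iff {M : Matrix ι ι ℝ} :
    M.PosSemidef ↔ Mᵀ = M ∧ ∀ x : ι → ℝ, 0 ≤ x ⬝ᵥ M *ᵥ x := by
  rw [posSemidef_iff_dotProduct_mulVec]
  simp [IsHermitian]

theorem real_posDef_iff {M : Matrix ι ι ℝ} :
    M.PosDef ↔ Mᵀ = M ∧ ∀ x : ι → ℝ, x ≠ 0 → 0 < x ⬝ᵥ M *ᵥ x := by
  rw [posDef_iff_dotProduct_mulVec]
  simp [IsHermitian]

theorem Matrix.PosSemidef.transpose_eq {M : Matrix ι ι ℝ} (h : M.PosSemidef) : Mᵀ = M :=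
  (real_posSemidef_iff.1 h).1

theorem Matrix.PosSemidef.quad_nonneg {M : Matrix ι ι ℝ} (h : M.PosSemidef) (x : ι → ℝ) :
    0 ≤ x ⬝ᵥ M *ᵥ x :=
  (real_posSemidef_iff.1 h).2 x

theorem Matrix.PosSemidef.mulVec_eq_zero_of_quad {M : Matrix ι ι ℝ} (h : M.PosSemidef)
    {x : ι → ℝ} (hx : x ⬝ᵥ M *ᵥ x = 0) : M *ᵥ x = 0 := by
  have := (h.dotProduct_mulVec_zero_iff x).1
  simp only [star_trivial] at this
  exact this hx

theorem posSemidef_transpose_mul_self (H : Matrix κ ι ℝ) : (Hᵀ * H).PosSemidef := by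
  simpa using posSemidef_conjTranspose_mul_self H

theorem posSemidef_transpose_mul_mul {M : Matrix κ κ ℝ} (hM : M.PosSemidef) (H : Matrix κ ι ℝ) :
    (Hᵀ * M * H).PosSemidef := by
  simpa using hM.conjTranspose_mul_mul_same H

theorem quad_transpose_mul_mul (M : Matrix κ κ ℝ) (H : Matrix κ ι ℝ) (x : ι → ℝ) :
    x ⬝ᵥ (Hᵀ * M * H) *ᵥ x = (H *ᵥ x) ⬝ᵥ M *ᵥ (H *ᵥ x) := by
  simp [← mulVec_mulVec, dotProduct_mulVec, vecMul_transpose]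

theorem continuous_quad (M : Matrix ι ι ℝ) : Continuous fun x : ι → ℝ => x ⬝ᵥ M *ᵥ x := by
  fun_prop

theorem quad_smul (M : Matrix ι ι ℝ) (a : ℝ) (x : ι → ℝ) :
    (a • x) ⬝ᵥ M *ᵥ (a • x) = a ^ 2 * (x ⬝ᵥ M *ᵥ x) := by
  simp [mulVec_smul]; ring

/-- A continuous, quadratically homogeneous function attains its minimal ratio to a positive
definite form. -/
theorem exists_ratio_minimizer [Nonempty ι] {g : (ι → ℝ) → ℝ} (hg : Continuous g)
    (hom : ∀ (a : ℝ) x, g (a • x) = a ^ 2 * g x) {V : Matrix ι ι ℝ} (hV : V.PosDef) :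
    ∃ u : ι → ℝ, u ≠ 0 ∧ ∀ x, g u * (x ⬝ᵥ V *ᵥ x) ≤ g x * (u ⬝ᵥ V *ᵥ u) := by
  have hVp := (real_posDef_iff.1 hV).2
  have hne : ∀ x ∈ Metric.sphere (0 : ι → ℝ) 1, x ≠ 0 := by
    intro x hx h; simp [h] at hx
  obtain ⟨u, hu, hmin⟩ := (isCompact_sphere (0 : ι → ℝ) 1).exists_isMinOn
    (NormedSpace.sphere_nonempty.2 zero_le_one)
    (f := fun x => g x / (x ⬝ᵥ V *ᵥ x))
    (hg.continuousOn.div (continuous_quad V).continuousOn fun x hx => (hVp x (hne x hx)).ne')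
  refine ⟨u, hne u hu, fun x => ?_⟩
  by_cases hx : x = 0
  · have h0 : g 0 = 0 := by simpa using hom 0 0
    rw [hx, h0, zero_dotProduct, mul_zero, zero_mul]
  have hn : ‖x‖ ≠ 0 := norm_ne_zero_iff.2 hx
  have hy : ‖x‖⁻¹ • x ∈ Metric.sphere (0 : ι → ℝ) 1 := by
    rw [mem_sphere_zero_iff_norm, norm_smul, norm_inv, norm_norm, inv_mul_cancel₀ hn]
  have h1 := isMinOn_iff.1 hmin _ hy
  rw [div_le_div_iff₀ (hVp _ (hne u hu)) (hVp _ (hne _ hy)), hom, quad_smul] at h1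
  have hp : 0 < (‖x‖⁻¹) ^ 2 := by positivity
  nlinarith

/-- Finsler's lemma. -/
theorem exists_posDef_add_smul {A B : Matrix ι ι ℝ} (hA : A.PosSemidef) (hB : Bᵀ = B)
    (h : ∀ x : ι → ℝ, x ≠ 0 → x ⬝ᵥ A *ᵥ x = 0 → 0 < x ⬝ᵥ B *ᵥ x) :
    ∃ ε : ℝ, 0 < ε ∧ (A + ε • B).PosDef := by
  have hScpt := isCompact_sphere (0 : ι → ℝ) 1
  have hne : ∀ x ∈ Metric.sphere (0 : ι → ℝ) 1, x ≠ 0 := by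
    intro x hx h; simp [h] at hx
  have main : ∃ ε : ℝ, 0 < ε ∧ ∀ x ∈ Metric.sphere (0 : ι → ℝ) 1,
      0 < x ⬝ᵥ A *ᵥ x + ε * (x ⬝ᵥ B *ᵥ x) := by
    obtain ⟨M, hM⟩ := hScpt.exists_bound_of_continuousOn (continuous_quad B).continuousOn
    have hKc : IsCompact (Metric.sphere (0 : ι → ℝ) 1 ∩ {x | x ⬝ᵥ B *ᵥ x ≤ 0}) :=
      hScpt.inter_right (isClosed_le (continuous_quad B) continuous_const)
    rcases (Metric.sphere (0 : ι → ℝ) 1 ∩ {x | x ⬝ᵥ B *ᵥ x ≤ 0}).eq_empty_or_nonempty with he | hn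
    · refine ⟨1, one_pos, fun x hx => ?_⟩
      have : 0 < x ⬝ᵥ B *ᵥ x := by
        by_contra hc
        have : x ∈ Metric.sphere (0 : ι → ℝ) 1 ∩ {x | x ⬝ᵥ B *ᵥ x ≤ 0} := ⟨hx, not_lt.1 hc⟩
        rw [he] at this; exact this
      have := hA.quad_nonneg x
      linarith
    · obtain ⟨u, hu, hmin⟩ := hKc.exists_isMinOn hn (continuous_quad A).continuousOn
      have hm : 0 < u ⬝ᵥ A *ᵥ u := by
        refine lt_of_le_of_ne (hA.quad_nonneg u) fun h0 => ?_
        exact absurd (h u (hne u hu.1) h0.symm) (not_lt.2 hu.2)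
      have hM0 : 0 ≤ M := (norm_nonneg _).trans (hM u hu.1)
      -- Where the form of `B` is nonpositive it is still at least `-M`, while that of `A` is at
      -- least its minimum there; `M + 1` avoids division by zero.
      refine ⟨(u ⬝ᵥ A *ᵥ u) / (M + 1), by positivity, fun x hx => ?_⟩
      rcases lt_or_ge 0 (x ⬝ᵥ B *ᵥ x) with hb | hb
      · have := hA.quad_nonneg x
        positivity
      · have h1 := isMinOn_iff.1 hmin x ⟨hx, hb⟩
        have h2 := (abs_le.1 (hM x hx)).1
        have h3 : (u ⬝ᵥ A *ᵥ u) / (M + 1) * (M + 1) = u ⬝ᵥ A *ᵥ u := by field_simp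
        have h4 : 0 < (u ⬝ᵥ A *ᵥ u) / (M + 1) := by positivity
        nlinarith
  obtain ⟨ε, hε, hS⟩ := main
  refine ⟨ε, hε, real_posDef_iff.2 ⟨by simp [hA.transpose_eq, hB], fun x hx => ?_⟩⟩
  have hn : ‖x‖ ≠ 0 := norm_ne_zero_iff.2 hx
  have hy : ‖x‖⁻¹ • x ∈ Metric.sphere (0 : ι → ℝ) 1 := by
    rw [mem_sphere_zero_iff_norm, norm_smul, norm_inv, norm_norm, inv_mul_cancel₀ hn]
  have h1 := hS _ hy
  rw [quad_smul, quad_smul] at h1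
  have hp : 0 < (‖x‖⁻¹) ^ 2 := by positivity
  simp only [add_mulVec, smul_mulVec, dotProduct_add, dotProduct_smul, smul_eq_mul]
  by_contra hc
  nlinarith

theorem exists_posDef_add_smul_of_posDef {A B : Matrix ι ι ℝ} (hA : A.PosDef) (hB : Bᵀ = B) :
    ∃ ε : ℝ, 0 < ε ∧ (A + ε • B).PosDef :=
  exists_posDef_add_smul hA.posSemidef hB fun x hx h0 =>
    absurd h0 ((real_posDef_iff.1 hA).2 x hx).ne'

theorem eq_zero_of_quad_eq_zero {X : Matrix ι ι ℝ} (hX : Xᵀ = X)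
    (h : ∀ x : ι → ℝ, x ⬝ᵥ X *ᵥ x = 0) : X = 0 := by
  have hp : X.PosSemidef := real_posSemidef_iff.2 ⟨hX, fun x => (h x).ge⟩
  classical
  refine Matrix.ext_of_mulVec_single fun i => ?_
  rw [hp.mulVec_eq_zero_of_quad (h _), zero_mulVec]

theorem eq_zero_of_posSemidef_of_neg {X : Matrix ι ι ℝ} (h1 : X.PosSemidef)
    (h2 : (-X).PosSemidef) : X = 0 :=
  eq_zero_of_quad_eq_zero h1.transpose_eq fun x =>
    le_antisymm (by simpa [neg_mulVec] using h2.quad_nonneg x) (h1.quad_nonneg x)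

theorem Matrix.PosSemidef.abs_apply_le_trace {X : Matrix ι ι ℝ} (hX : X.PosSemidef) (i j : ι) :
    |X i j| ≤ X.trace := by
  classical
  have hd : ∀ k, 0 ≤ X k k := fun k => hX.diag_nonneg
  have hs : X j i = X i j := by
    have := congrFun (congrFun hX.transpose_eq i) j
    simpa using this
  have hle : ∀ k, X k k ≤ X.trace := fun k =>
    Finset.single_le_sum (f := fun k => X k k) (fun k _ => hd k) (Finset.mem_univ k)
  have h1 := hX.quad_nonneg (Pi.single i 1 + Pi.single j 1)
  have h2 := hX.quad_nonneg (Pi.single i 1 - Pi.single j 1)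
  simp [mulVec_add, mulVec_sub, hs] at h1 h2
  rw [abs_le]
  constructor <;> linarith [hle i, hle j]

theorem Matrix.PosSemidef.eq_zero_of_trace_nonpos {X : Matrix ι ι ℝ} (hX : X.PosSemidef)
    (h : X.trace ≤ 0) : X = 0 := by
  ext i j
  exact abs_nonpos_iff.1 ((hX.abs_apply_le_trace i j).trans h)

theorem isClosed_posSemidef : IsClosed {X : Matrix ι ι ℝ | X.PosSemidef} := by
  have : {X : Matrix ι ι ℝ | X.PosSemidef}
      = {X | Xᵀ = X} ∩ ⋂ x : ι → ℝ, {X | 0 ≤ x ⬝ᵥ X *ᵥ x} := by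
    ext X; simp [real_posSemidef_iff]
  rw [this]
  refine (isClosed_eq (by fun_prop) continuous_id).inter (isClosed_iInter fun x => ?_)
  exact isClosed_le continuous_const (by fun_prop)

theorem isCompact_posSemidef_trace_le (c : ℝ) :
    IsCompact {X : Matrix ι ι ℝ | X.PosSemidef ∧ X.trace ≤ c} := by
  have hbox : IsCompact (Set.univ.pi fun _ : ι => Set.univ.pi fun _ : ι => Set.Icc (-c) c) :=
    isCompact_univ_pi fun _ => isCompact_univ_pi fun _ => isCompact_Icc
  refine IsCompact.of_isClosed_subset hbox ?_ ?_
  · exact isClosed_posSemidef.inter (isClosed_le continuous_id.matrix_trace continuous_const)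
  · rintro X ⟨hX, hc⟩ i - j -
    exact abs_le.1 ((hX.abs_apply_le_trace i j).trans hc)

end QuadraticForms

/-! ### Generalized Lyapunov operators and stability certificates. -/

section GeneralizedLyapunov

variable {ι κ : Type*} [Fintype ι] [Fintype κ]

/-- `X ↦ Fᵀ X + X F + Nᵀ X N` over an arbitrary finite index type. -/
def genLyap {S : Type*} [CommRing S] (F N X : Matrix ι ι S) : Matrix ι ι S :=
  Fᵀ * X + X * F + Nᵀ * X * N

section Algebra

variable {S : Type*} [CommRing S] (F N : Matrix ι ι S)

theorem genLyap_add (X Y : Matrix ι ι S) :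
    genLyap F N (X + Y) = genLyap F N X + genLyap F N Y := by
  simp only [genLyap, Matrix.mul_add, Matrix.add_mul]; abel

theorem genLyap_neg (X : Matrix ι ι S) : genLyap F N (-X) = -genLyap F N X := by
  simp only [genLyap, Matrix.mul_neg, Matrix.neg_mul]; abel

theorem genLyap_sub (X Y : Matrix ι ι S) :
    genLyap F N (X - Y) = genLyap F N X - genLyap F N Y := by
  rw [sub_eq_add_neg, genLyap_add, genLyap_neg, ← sub_eq_add_neg]

theorem genLyap_smul (c : S) (X : Matrix ι ι S) : genLyap F N (c • X) = c • genLyap F N X := by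
  simp only [genLyap, Matrix.mul_smul, Matrix.smul_mul, smul_add]

theorem genLyap_zero : genLyap F N (0 : Matrix ι ι S) = 0 := by simp [genLyap]

theorem genLyap_transpose (X : Matrix ι ι S) : (genLyap F N X)ᵀ = genLyap F N Xᵀ := by
  simp only [genLyap, transpose_add, transpose_mul, transpose_transpose, Matrix.mul_assoc]; abel

theorem genLyap_add_smul_one [DecidableEq ι] (a : S) (X : Matrix ι ι S) :
    genLyap (F + a • (1 : Matrix ι ι S)) N X = genLyap F N X + (2 * a) • X := by
  simp only [genLyap, transpose_add, transpose_smul, transpose_one, Matrix.add_mul, Matrix.mul_add,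
    Matrix.smul_mul, Matrix.mul_smul, Matrix.one_mul, Matrix.mul_one, two_mul, add_smul]
  abel

theorem genLyap_sub_smul_one [DecidableEq ι] (a : S) (X : Matrix ι ι S) :
    genLyap (F - a • (1 : Matrix ι ι S)) N X = genLyap F N X - (2 * a) • X := by
  rw [sub_eq_add_neg, ← neg_smul, genLyap_add_smul_one, mul_neg, neg_smul, sub_eq_add_neg]

end Algebra

theorem quad_genLyap (F N : Matrix ι ι ℝ) {X : Matrix ι ι ℝ} (hX : Xᵀ = X) (x : ι → ℝ) :
    x ⬝ᵥ genLyap F N X *ᵥ x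
      = 2 * ((F *ᵥ x) ⬝ᵥ X *ᵥ x) + (N *ᵥ x) ⬝ᵥ X *ᵥ (N *ᵥ x) := by
  have h1 : x ⬝ᵥ (Fᵀ * X) *ᵥ x = (F *ᵥ x) ⬝ᵥ X *ᵥ x := by
    rw [← mulVec_mulVec, dotProduct_mulVec, vecMul_transpose]
  have h2 : x ⬝ᵥ (X * F) *ᵥ x = (F *ᵥ x) ⬝ᵥ X *ᵥ x := by
    rw [← mulVec_mulVec, dotProduct_mulVec, ← mulVec_transpose, hX, dotProduct_comm]
  simp only [genLyap, add_mulVec, dotProduct_add, quad_transpose_mul_mul, h1, h2]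
  ring

/-- A null vector of a semidefinite `X` lies in its kernel, which kills the drift terms and leaves
only the nonnegative diffusion term. Every maximum-principle argument below rests on this
positivity. -/
theorem quad_genLyap_nonneg (F N : Matrix ι ι ℝ) {X : Matrix ι ι ℝ} (hX : X.PosSemidef)
    {u : ι → ℝ} (hu : u ⬝ᵥ X *ᵥ u = 0) : 0 ≤ u ⬝ᵥ genLyap F N X *ᵥ u := by
  rw [quad_genLyap F N hX.transpose_eq, hX.mulVec_eq_zero_of_quad hu, dotProduct_zero,
    mul_zero, zero_add]
  exact hX.quad_nonneg _

/-- Existence of a strict Lyapunov certificate. -/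
def IsLyapStable (F N : Matrix ι ι ℝ) : Prop :=
  ∃ V : Matrix ι ι ℝ, V.PosDef ∧ (-genLyap F N V).PosDef

theorem posDef_of_neg_genLyap_posDef {F N V : Matrix ι ι ℝ} (hV : V.PosSemidef)
    (h : (-genLyap F N V).PosDef) : V.PosDef := by
  refine real_posDef_iff.2 ⟨hV.transpose_eq, fun x hx => ?_⟩
  refine lt_of_le_of_ne (hV.quad_nonneg x) fun h0 => ?_
  have h1 := quad_genLyap_nonneg F N hV h0.symm
  have h2 := (real_posDef_iff.1 h).2 x hx
  rw [neg_mulVec, dotProduct_neg] at h2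
  linarith

namespace IsLyapStable

variable {F N : Matrix ι ι ℝ}

/-- Maximum principle. -/
theorem posSemidef (h : IsLyapStable F N) {X : Matrix ι ι ℝ} (hX : Xᵀ = X)
    (hL : (-genLyap F N X).PosSemidef) : X.PosSemidef := by
  obtain ⟨V, hV, hVL⟩ := h
  rcases isEmpty_or_nonempty ι with he | he
  · have : X = 0 := Subsingleton.elim _ _
    rw [this]; exact PosSemidef.zero
  obtain ⟨u, hu, hmin⟩ := exists_ratio_minimizer (continuous_quad X) (quad_smul X) hV
  have hVu := (real_posDef_iff.1 hV).2 u hu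
  have hXu : 0 ≤ u ⬝ᵥ X *ᵥ u := by
    by_contra! hneg
    -- Subtracting the minimal ratio times `V` from `X` leaves a semidefinite form vanishing at `u`.
    -- If the ratio is negative, the operator applied to this form is negative at `u`, contradicting
    -- `quad_genLyap_nonneg`.
    have hW : ((u ⬝ᵥ V *ᵥ u) • X + (-(u ⬝ᵥ X *ᵥ u)) • V).PosSemidef := by
      refine real_posSemidef_iff.2 ⟨by simp [hX, hV.posSemidef.transpose_eq], fun x => ?_⟩
      have := hmin x
      simp only [add_mulVec, smul_mulVec, dotProduct_add, dotProduct_smul, smul_eq_mul]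
      linarith
    have h0 := quad_genLyap_nonneg F N hW (u := u) (by
      simp only [add_mulVec, smul_mulVec, dotProduct_add, dotProduct_smul, smul_eq_mul]; ring)
    have h1 := hL.quad_nonneg u
    have h2 := (real_posDef_iff.1 hVL).2 u hu
    rw [genLyap_add, genLyap_smul, genLyap_smul] at h0
    simp only [add_mulVec, smul_mulVec, dotProduct_add, dotProduct_smul, smul_eq_mul,
      neg_mulVec, dotProduct_neg] at h0 h1 h2
    nlinarith
  refine real_posSemidef_iff.2 ⟨hX, fun x => ?_⟩
  have h1 := hmin x
  have h2 := hV.posSemidef.quad_nonneg x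
  by_contra! h3
  nlinarith [mul_nonneg hXu h2]

theorem eq_zero (h : IsLyapStable F N) {X : Matrix ι ι ℝ} (hX : Xᵀ = X)
    (hL : genLyap F N X = 0) : X = 0 := by
  refine eq_zero_of_posSemidef_of_neg (h.posSemidef hX ?_) (h.posSemidef (by simp [hX]) ?_)
  · rw [hL, neg_zero]; exact PosSemidef.zero
  · rw [genLyap_neg, hL, neg_zero, neg_zero]; exact PosSemidef.zero

/-- Uniqueness on symmetric matrices gives existence by finite dimension. To work on the full matrix
space, `T` acts as the Lyapunov operator on the symmetric part and as a nonzero multiple of the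
identity on the skew part. -/
theorem exists_solution (h : IsLyapStable F N) {Y : Matrix ι ι ℝ} (hY : Yᵀ = Y) :
    ∃ X : Matrix ι ι ℝ, Xᵀ = X ∧ genLyap F N X = Y := by
  let T : Matrix ι ι ℝ →ₗ[ℝ] Matrix ι ι ℝ :=
    { toFun := fun X => genLyap F N (X + Xᵀ) + (X - Xᵀ)
      map_add' := fun X Z => by
        simp only [transpose_add, genLyap_add]; abel
      map_smul' := fun c X => by
        simp only [transpose_smul, genLyap_add, genLyap_smul, smul_add, smul_sub, RingHom.id_apply] }
  have hT : ∀ X Z : Matrix ι ι ℝ, Zᵀ = Z → T X = Z → Xᵀ = X ∧ genLyap F N (X + Xᵀ) = Z := by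
    intro X Z hZ hTX
    have h1 : genLyap F N (X + Xᵀ) + (X - Xᵀ) = Z := hTX
    have h2 : genLyap F N (X + Xᵀ) + (Xᵀ - X) = Z := by
      have := congrArg transpose h1
      rwa [transpose_add, genLyap_transpose, transpose_add, transpose_sub, transpose_transpose,
        hZ, add_comm Xᵀ X] at this
    have h3 : X - Xᵀ = Xᵀ - X := add_left_cancel (h1.trans h2.symm)
    have h4 : Xᵀ = X := by
      ext i j
      have := Matrix.ext_iff.2 h3 i j
      simp only [Matrix.sub_apply, transpose_apply] at this ⊢
      linarith
    refine ⟨h4, ?_⟩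
    rwa [sub_eq_zero.2 h4.symm, add_zero] at h1
  have hinj : Function.Injective T := by
    refine (injective_iff_map_eq_zero T).2 fun X hX => ?_
    obtain ⟨h1, h2⟩ := hT X 0 transpose_zero hX
    have h3 := h.eq_zero (by rw [transpose_add, transpose_transpose, add_comm]) h2
    rw [h1, ← two_smul ℝ] at h3
    simpa using h3
  obtain ⟨X, hX⟩ := (LinearMap.injective_iff_surjective.1 hinj) Y
  obtain ⟨h1, h2⟩ := hT X Y hY hX
  exact ⟨X + Xᵀ, by rw [transpose_add, transpose_transpose, add_comm], h2⟩

theorem sub_smul_one [DecidableEq ι] (h : IsLyapStable F N) {a : ℝ} (ha : 0 ≤ a) :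
    IsLyapStable (F - a • (1 : Matrix ι ι ℝ)) N := by
  obtain ⟨V, hV, hVL⟩ := h
  refine ⟨V, hV, ?_⟩
  rw [genLyap_sub_smul_one, neg_sub, sub_eq_add_neg]
  exact PosDef.posSemidef_add (hV.posSemidef.smul (by positivity)) hVL

theorem exists_add_smul_one [DecidableEq ι] (h : IsLyapStable F N) :
    ∃ a : ℝ, 0 < a ∧ IsLyapStable (F + a • (1 : Matrix ι ι ℝ)) N := by
  obtain ⟨V, hV, hVL⟩ := h
  obtain ⟨ε, hε, hp⟩ := exists_posDef_add_smul_of_posDef hVL (B := -V)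
    (by simp [hV.posSemidef.transpose_eq])
  refine ⟨ε / 2, by positivity, V, hV, ?_⟩
  rw [genLyap_add_smul_one]
  convert hp using 1
  rw [mul_div_cancel₀ _ two_ne_zero, neg_add, smul_neg]

/-- Stochastic detectability: output injection with a quadratic output penalty preserves
stability. -/
theorem of_detectable {F₀ N₀ : Matrix ι ι ℝ} (h : IsLyapStable F₀ N₀) {X : Matrix ι ι ℝ}
    (hX : X.PosSemidef) (hL : (-genLyap F N X).PosSemidef)
    (hout : ∀ x : ι → ℝ, x ⬝ᵥ (-genLyap F N X) *ᵥ x = 0 → F *ᵥ x = F₀ *ᵥ x ∧ N *ᵥ x = N₀ *ᵥ x) :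
    IsLyapStable F N := by
  obtain ⟨V, hV, hVL⟩ := h
  have hVs := hV.posSemidef.transpose_eq
  -- Where the decay of `X` degenerates, the two loops agree, so `V` decays strictly there;
  -- Finsler's lemma then makes `X + ε • V` a strict certificate.
  obtain ⟨ε, hε, hp⟩ := exists_posDef_add_smul hL (B := -genLyap F N V)
    (by rw [transpose_neg, genLyap_transpose, hVs]) fun x hx h0 => by
      obtain ⟨h1, h2⟩ := hout x h0
      have := (real_posDef_iff.1 hVL).2 x hx
      rw [neg_mulVec, dotProduct_neg, quad_genLyap _ _ hVs] at this ⊢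
      rwa [h1, h2]
  refine ⟨X + ε • V, PosDef.posSemidef_add hX (hV.smul hε), ?_⟩
  rw [genLyap_add, genLyap_smul, neg_add, ← smul_neg]
  exact hp

end IsLyapStable

theorem exists_normalized_certificate [DecidableEq ι] [Nonempty ι] {F N : Matrix ι ι ℝ}
    (h : IsLyapStable F N) : ∃ (V : Matrix ι ι ℝ) (c : ℝ), V.PosSemidef ∧ V.trace = 1 ∧ 0 ≤ c ∧
      genLyap F N V = -(c • (1 : Matrix ι ι ℝ)) := by
  obtain ⟨V, hVs, hV⟩ := h.exists_solution (Y := -(1 : Matrix ι ι ℝ)) (by simp)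
  have hVp : V.PosSemidef := h.posSemidef hVs (by rw [hV, neg_neg]; exact PosSemidef.one)
  have htr : 0 < V.trace := by
    by_contra! h0
    rw [hVp.eq_zero_of_trace_nonpos h0, genLyap_zero] at hV
    exact one_ne_zero (neg_eq_zero.1 hV.symm)
  refine ⟨V.trace⁻¹ • V, V.trace⁻¹, hVp.smul (by positivity), ?_, by positivity, ?_⟩
  · rw [trace_smul, smul_eq_mul, inv_mul_cancel₀ htr.ne']
  · rw [genLyap_smul, hV, smul_neg]

/-- If no nonnegative real number is an eigenvalue of the generalized Lyapunov operator on
symmetric matrices, then there is a Lyapunov certificate. -/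
theorem isLyapStable_of_no_nonneg_eigenvalue {F N : Matrix ι ι ℝ}
    (h : ∀ t : ℝ, 0 ≤ t → ∀ X : Matrix ι ι ℝ, Xᵀ = X → genLyap F N X = t • X → X = 0) :
    IsLyapStable F N := by
  classical
  rcases isEmpty_or_nonempty ι with he | he
  · have hp : ∀ M : Matrix ι ι ℝ, M.PosDef := fun M => by
      rw [Subsingleton.elim M 1]; exact PosDef.one
    exact ⟨1, hp _, hp _⟩
  -- Continuation in the shift `t`: for `t = ε⁻¹` the identity matrix is a certificate, and the aim
  -- is to lower `t` to zero.
  obtain ⟨ε, hε, hp⟩ := exists_posDef_add_smul_of_posDef (A := (1 : Matrix ι ι ℝ)) PosDef.one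
    (B := -genLyap F N 1) (by rw [transpose_neg, genLyap_transpose, transpose_one])
  have hstart : IsLyapStable (F - (ε⁻¹ / 2) • (1 : Matrix ι ι ℝ)) N := by
    refine ⟨1, PosDef.one, ?_⟩
    rw [genLyap_sub_smul_one, mul_div_cancel₀ _ two_ne_zero]
    convert hp.smul (inv_pos.2 hε) using 1
    rw [smul_add, smul_smul, inv_mul_cancel₀ hε.ne', one_smul]
    abel
  -- Taking traces in the normalized equation determines its constant as a continuous function of
  -- `(t, V)`, so the set `K` of normalized solutions is compact and has a least `t`.
  let lam : ℝ × Matrix ι ι ℝ → ℝ := fun p =>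
    -((genLyap F N p.2).trace - p.1 * p.2.trace) / Fintype.card ι
  have hcard : (Fintype.card ι : ℝ) ≠ 0 := by simp
  let K : Set (ℝ × Matrix ι ι ℝ) :=
    (Set.Icc 0 ε⁻¹ ×ˢ {V : Matrix ι ι ℝ | V.PosSemidef ∧ V.trace ≤ 1}) ∩
      {p | p.2.trace = 1 ∧ 0 ≤ lam p ∧
        genLyap F N p.2 - p.1 • p.2 = -(lam p • (1 : Matrix ι ι ℝ))}
  have hcL : Continuous fun p : ℝ × Matrix ι ι ℝ => genLyap F N p.2 := by
    unfold genLyap; fun_prop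
  have hclam : Continuous lam := by
    have h1 : Continuous fun p : ℝ × Matrix ι ι ℝ => (genLyap F N p.2).trace := hcL.matrix_trace
    have h2 : Continuous fun p : ℝ × Matrix ι ι ℝ => p.2.trace := continuous_snd.matrix_trace
    exact ((h1.sub (continuous_fst.mul h2)).neg).div_const _
  have hKc : IsCompact K := by
    refine (isCompact_Icc.prod (isCompact_posSemidef_trace_le 1)).inter_right ?_
    refine (isClosed_eq continuous_snd.matrix_trace continuous_const).inter
      ((isClosed_le continuous_const hclam).inter (isClosed_eq ?_ ?_))
    · exact hcL.sub (continuous_fst.smul continuous_snd)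
    · exact (hclam.smul continuous_const).neg
  have hmemK : ∀ t : ℝ, 0 ≤ t → t ≤ ε⁻¹ → IsLyapStable (F - (t / 2) • (1 : Matrix ι ι ℝ)) N →
      ∃ V, (t, V) ∈ K := by
    intro t h0 h1 hs
    obtain ⟨V, c, hV, htr, hc, hE⟩ := exists_normalized_certificate hs
    rw [genLyap_sub_smul_one, mul_div_cancel₀ _ two_ne_zero] at hE
    have hlam : lam (t, V) = c := by
      have := congrArg trace hE
      rw [trace_sub, trace_smul, trace_neg, trace_smul, trace_one, smul_eq_mul, smul_eq_mul] at this
      simp only [lam, this]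
      field_simp
    exact ⟨V, ⟨⟨h0, h1⟩, hV, htr.le⟩, htr, by rw [hlam]; exact hc, by rw [hlam]; exact hE⟩
  obtain ⟨V₁, hV₁⟩ := hmemK ε⁻¹ (by positivity) le_rfl hstart
  obtain ⟨⟨t, V⟩, hp, hmin⟩ := hKc.exists_isMinOn ⟨_, hV₁⟩ continuous_fst.continuousOn
  obtain ⟨⟨⟨ht0, htT⟩, hV, -⟩, htr, hlam, hE⟩ := hp
  simp only at ht0 htT hV htr hE
  -- A zero constant would make `V` an eigenvector for the eigenvalue `t ≥ 0`, which is excluded.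
  -- Hence the least `t` is itself stable.
  have hlam0 : 0 < lam (t, V) := by
    refine lt_of_le_of_ne hlam fun h0 => ?_
    rw [← h0, zero_smul, neg_zero, sub_eq_zero] at hE
    rw [h t ht0 V hV.transpose_eq hE, trace_zero] at htr
    exact zero_ne_one htr
  have hstab : IsLyapStable (F - (t / 2) • (1 : Matrix ι ι ℝ)) N := by
    have hd : (-genLyap (F - (t / 2) • (1 : Matrix ι ι ℝ)) N V).PosDef := by
      rw [genLyap_sub_smul_one, mul_div_cancel₀ _ two_ne_zero, hE, neg_neg]
      exact PosDef.one.smul hlam0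
    exact ⟨V, posDef_of_neg_genLyap_posDef hV hd, hd⟩
  rcases ht0.eq_or_lt with h0 | h0
  · rw [← h0, zero_div, zero_smul, sub_zero] at hstab
    exact hstab
  · exfalso
    obtain ⟨a, ha, hs⟩ := hstab.exists_add_smul_one
    -- Openness of stability permits a shift smaller by `2 * a`; the maximum keeps it nonnegative,
    -- so minimality of `t` is contradicted.
    have ht1 : max 0 (t - 2 * a) < t := max_lt h0 (by linarith)
    have hs' := hs.sub_smul_one (a := (max 0 (t - 2 * a) - (t - 2 * a)) / 2)
      (by have := le_max_right 0 (t - 2 * a); linarith)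
    have heq : F - (t / 2) • (1 : Matrix ι ι ℝ) + a • (1 : Matrix ι ι ℝ)
        - ((max 0 (t - 2 * a) - (t - 2 * a)) / 2) • (1 : Matrix ι ι ℝ)
        = F - (max 0 (t - 2 * a) / 2) • (1 : Matrix ι ι ℝ) := by
      module
    rw [heq] at hs'
    obtain ⟨V₂, hV₂⟩ := hmemK _ (le_max_left _ _) (ht1.le.trans htT) hs'
    have := isMinOn_iff.1 hmin _ hV₂
    exact absurd this (not_le.2 ht1)

end GeneralizedLyapunov

/-! ### Block-diagonal systems and mixed Lyapunov-Sylvester equations. -/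

section Blocks

variable {ι κ : Type*} [Fintype ι] [Fintype κ]

theorem genLyap_fromBlocks {S : Type*} [CommRing S] (F N X : Matrix ι ι S) (G M W : Matrix κ κ S)
    (Y : Matrix ι κ S) (Z : Matrix κ ι S) :
    genLyap (fromBlocks F 0 0 G) (fromBlocks N 0 0 M) (fromBlocks X Y Z W)
      = fromBlocks (genLyap F N X) (Fᵀ * Y + Y * G + Nᵀ * Y * M)
          (Gᵀ * Z + Z * F + Mᵀ * Z * N) (genLyap G M W) := by
  simp [genLyap, fromBlocks_transpose, fromBlocks_multiply, fromBlocks_add]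

theorem quad_fromBlocks (A : Matrix ι ι ℝ) (B : Matrix ι κ ℝ) (C : Matrix κ ι ℝ)
    (D : Matrix κ κ ℝ) (u : ι → ℝ) (v : κ → ℝ) :
    (Sum.elim u v) ⬝ᵥ (fromBlocks A B C D) *ᵥ (Sum.elim u v)
      = u ⬝ᵥ A *ᵥ u + u ⬝ᵥ B *ᵥ v + (v ⬝ᵥ C *ᵥ u + v ⬝ᵥ D *ᵥ v) := by
  rw [fromBlocks_mulVec, sumElim_dotProduct_sumElim, dotProduct_add, dotProduct_add]
  rfl

theorem posDef_fromBlocks_diagonal {A : Matrix ι ι ℝ} {D : Matrix κ κ ℝ} (hA : A.PosDef)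
    (hD : D.PosDef) : (fromBlocks A 0 0 D).PosDef := by
  refine real_posDef_iff.2 ⟨?_, fun x hx => ?_⟩
  · rw [fromBlocks_transpose, hA.posSemidef.transpose_eq, hD.posSemidef.transpose_eq,
      transpose_zero, transpose_zero]
  · rw [← Sum.elim_comp_inl_inr x, quad_fromBlocks]
    simp only [zero_mulVec, dotProduct_zero, add_zero, zero_add]
    by_cases hu : x ∘ Sum.inl = 0
    · have hv : x ∘ Sum.inr ≠ 0 := by
        intro hv
        apply hx
        rw [← Sum.elim_comp_inl_inr x, hu, hv]
        ext i; cases i <;> rfl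
      exact add_pos_of_nonneg_of_pos (hA.posSemidef.quad_nonneg _) ((real_posDef_iff.1 hD).2 _ hv)
    · exact add_pos_of_pos_of_nonneg ((real_posDef_iff.1 hA).2 _ hu) (hD.posSemidef.quad_nonneg _)

theorem IsLyapStable.fromBlocks {F N : Matrix ι ι ℝ} {G M : Matrix κ κ ℝ}
    (h : IsLyapStable F N) (h' : IsLyapStable G M) :
    IsLyapStable (fromBlocks F 0 0 G) (fromBlocks N 0 0 M) := by
  obtain ⟨V, hV, hVL⟩ := h
  obtain ⟨W, hW, hWL⟩ := h'
  refine ⟨Matrix.fromBlocks V 0 0 W, posDef_fromBlocks_diagonal hV hW, ?_⟩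
  rw [genLyap_fromBlocks]
  simpa [fromBlocks_neg] using posDef_fromBlocks_diagonal hVL hWL

/-- The size of the index set times an entrywise bound dominates the operator norm of `E`; in the
proof, each product `u i * E i j * v j` is split by the arithmetic-geometric mean inequality. -/
theorem posSemidef_fromBlocks_smul_one [DecidableEq ι] {E : Matrix ι ι ℝ} {e : ℝ}
    (hE : ∀ i j, |E i j| ≤ e) :
    (fromBlocks ((Fintype.card ι * e) • (1 : Matrix ι ι ℝ)) E Eᵀ
      ((Fintype.card ι * e) • (1 : Matrix ι ι ℝ))).PosSemidef := by
  refine real_posSemidef_iff.2 ⟨by simp [fromBlocks_transpose], fun x => ?_⟩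
  rw [← Sum.elim_comp_inl_inr x, quad_fromBlocks]
  set u := x ∘ Sum.inl
  set v := x ∘ Sum.inr
  have h1 : v ⬝ᵥ Eᵀ *ᵥ u = u ⬝ᵥ E *ᵥ v := by
    rw [mulVec_transpose, dotProduct_comm, dotProduct_mulVec]
  have h2 : u ⬝ᵥ E *ᵥ v = ∑ i, ∑ j, u i * E i j * v j := by
    simp only [dotProduct, mulVec, Finset.mul_sum, mul_assoc]
  have h3 : ∑ i, ∑ j, -(e / 2) * (u i ^ 2 + v j ^ 2)
      = -(Fintype.card ι * e / 2) * (u ⬝ᵥ u + v ⬝ᵥ v) := by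
    simp only [← Finset.mul_sum, Finset.sum_add_distrib, Finset.sum_const, Finset.card_univ,
      nsmul_eq_mul, dotProduct, ← sq]
    ring
  have h4 : ∑ i, ∑ j, -(e / 2) * (u i ^ 2 + v j ^ 2) ≤ u ⬝ᵥ E *ᵥ v := by
    rw [h2]
    refine Finset.sum_le_sum fun i _ => Finset.sum_le_sum fun j _ => ?_
    obtain ⟨h5, h6⟩ := abs_le.1 (hE i j)
    nlinarith [mul_nonneg (sub_nonneg.2 h6) (sq_nonneg (u i - v j)),
      mul_nonneg (sub_nonneg.2 h5) (sq_nonneg (u i + v j))]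
  rw [h3] at h4
  rw [h1]
  simp only [smul_mulVec, one_mulVec, dotProduct_smul, smul_eq_mul]
  linarith

/-- Trace bound for a mixed Lyapunov-Sylvester equation in terms of the two diagonal
Lyapunov solutions. -/
theorem two_mul_trace_le_of_mixed [DecidableEq ι] {F N G M V W Y E : Matrix ι ι ℝ}
    (hF : IsLyapStable F N) (hG : IsLyapStable G M) (hVs : Vᵀ = V) (hWs : Wᵀ = W)
    (hV : genLyap F N V = -1) (hW : genLyap G M W = -1)
    (hY : Fᵀ * Y + Y * G + Nᵀ * Y * M = -E) {e : ℝ} (hE : ∀ i j, |E i j| ≤ e) :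
    2 * Y.trace ≤ Fintype.card ι * e * (V.trace + W.trace) := by
  have hYt : Gᵀ * Yᵀ + Yᵀ * F + Mᵀ * Yᵀ * N = -Eᵀ := by
    have := congrArg transpose hY
    simp only [transpose_add, transpose_mul, transpose_transpose, transpose_neg] at this
    rw [← this, Matrix.mul_assoc]; abel
  -- The maximum principle for the doubled system makes the off-diagonal block `Y` dominated by `V`
  -- and `W`; the vectors `(eᵢ, -eᵢ)` then read off the diagonal entries of `Y`.
  have hp : (fromBlocks ((Fintype.card ι * e) • V) Y Yᵀ ((Fintype.card ι * e) • W)).PosSemidef := by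
    refine (hF.fromBlocks hG).posSemidef (by simp [fromBlocks_transpose, hVs, hWs]) ?_
    rw [genLyap_fromBlocks, genLyap_smul, genLyap_smul, hV, hW, hY, hYt, fromBlocks_neg]
    simpa using posSemidef_fromBlocks_smul_one hE
  have hi : ∀ i, 2 * Y i i ≤ Fintype.card ι * e * (V i i + W i i) := by
    intro i
    have := hp.quad_nonneg (Sum.elim (Pi.single i 1) (-Pi.single i 1))
    rw [quad_fromBlocks] at this
    simp [mulVec_neg] at this
    linarith
  have := Finset.sum_le_sum fun i (_ : i ∈ Finset.univ) => hi i
  rwa [← Finset.mul_sum, ← Finset.mul_sum, Finset.sum_add_distrib] at this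

end Blocks

/-! ### Certificates force all complex eigenvalues into the left half-plane. -/

section ComplexEigenvalues

variable {ι : Type*} [Fintype ι]

theorem map_re_genLyap (F N : Matrix ι ι ℝ) (X : Matrix ι ι ℂ) :
    (genLyap (F.map Complex.ofReal) (N.map Complex.ofReal) X).map Complex.re
      = genLyap F N (X.map Complex.re) := by
  ext i j
  simp [genLyap, mul_apply, Complex.re_sum, Finset.sum_mul]

theorem map_im_genLyap (F N : Matrix ι ι ℝ) (X : Matrix ι ι ℂ) :
    (genLyap (F.map Complex.ofReal) (N.map Complex.ofReal) X).map Complex.im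
      = genLyap F N (X.map Complex.im) := by
  ext i j
  simp [genLyap, mul_apply, Complex.im_sum, Finset.sum_mul]

theorem IsLyapStable.re_lt_zero_of_symm {F N : Matrix ι ι ℝ} (h : IsLyapStable F N)
    {X : Matrix ι ι ℂ} (hXs : Xᵀ = X) (hX0 : X ≠ 0) {z : ℂ}
    (hz : genLyap (F.map Complex.ofReal) (N.map Complex.ofReal) X = z • X) : z.re < 0 := by
  obtain ⟨V, hV, hVL⟩ := h
  have hne : Nonempty ι := by
    by_contra hc
    rw [not_nonempty_iff] at hc
    exact hX0 (Subsingleton.elim _ _)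
  set A := X.map Complex.re with hAdef
  set B := X.map Complex.im with hBdef
  have hAs : Aᵀ = A := by rw [hAdef, ← transpose_map, hXs]
  have hBs : Bᵀ = B := by rw [hBdef, ← transpose_map, hXs]
  have hLA : genLyap F N A = z.re • A - z.im • B := by
    rw [hAdef, ← map_re_genLyap, hz]; ext i j; simp [hBdef]
  have hLB : genLyap F N B = z.im • A + z.re • B := by
    rw [hBdef, ← map_im_genLyap, hz]; ext i j; simp [hAdef]; ring
  -- `s x` is the modulus of the complex number `xᵀ X x`; the point `u` below maximizes its ratio to
  -- the form of `V`.
  let s : (ι → ℝ) → ℝ := fun x => √((x ⬝ᵥ A *ᵥ x) ^ 2 + (x ⬝ᵥ B *ᵥ x) ^ 2)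
  have hs0 : ∀ x, 0 ≤ s x := fun x => Real.sqrt_nonneg _
  have hs2 : ∀ x, s x ^ 2 = (x ⬝ᵥ A *ᵥ x) ^ 2 + (x ⬝ᵥ B *ᵥ x) ^ 2 := fun x =>
    Real.sq_sqrt (by positivity)
  have hsc : Continuous s :=
    (((continuous_quad A).pow 2).add ((continuous_quad B).pow 2)).sqrt
  have hsh : ∀ (a : ℝ) x, -s (a • x) = a ^ 2 * -s x := by
    intro a x
    simp only [s, quad_smul]
    rw [show (a ^ 2 * (x ⬝ᵥ A *ᵥ x)) ^ 2 + (a ^ 2 * (x ⬝ᵥ B *ᵥ x)) ^ 2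
      = (a ^ 2) ^ 2 * ((x ⬝ᵥ A *ᵥ x) ^ 2 + (x ⬝ᵥ B *ᵥ x) ^ 2) by ring,
      Real.sqrt_mul (by positivity), Real.sqrt_sq (by positivity)]
    ring
  obtain ⟨u, hu, hmin⟩ := exists_ratio_minimizer (g := fun x => -s x) hsc.neg hsh hV
  have hVu := (real_posDef_iff.1 hV).2 u hu
  have hr : 0 < s u := by
    refine lt_of_le_of_ne (hs0 u) fun h0 => hX0 ?_
    have hz0 : ∀ x, s x = 0 := by
      intro x
      have := hmin x
      rw [← h0] at this
      nlinarith [hs0 x]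
    have hA0 : A = 0 := eq_zero_of_quad_eq_zero hAs fun x => by
      have := hs2 x; rw [hz0 x] at this; nlinarith [sq_nonneg (x ⬝ᵥ B *ᵥ x)]
    have hB0 : B = 0 := eq_zero_of_quad_eq_zero hBs fun x => by
      have := hs2 x; rw [hz0 x] at this; nlinarith [sq_nonneg (x ⬝ᵥ A *ᵥ x)]
    ext i j
    exact Complex.ext (congrFun (congrFun hA0 i) j) (congrFun (congrFun hB0 i) j)
  set p := u ⬝ᵥ A *ᵥ u with hp
  set q := u ⬝ᵥ B *ᵥ u with hq
  set w := u ⬝ᵥ V *ᵥ u with hw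
  have hru : s u ^ 2 = p ^ 2 + q ^ 2 := hs2 u
  -- The combination `p • A + q • B` is the real part of `X` after rotating its phase so that the
  -- value at `u` is real; Cauchy-Schwarz bounds its form by `s u * s x`. In the operator applied to
  -- it, the `z.im` terms cancel at `u`.
  have hWp : ((s u ^ 2) • V + (-(w * p)) • A + (-(w * q)) • B).PosSemidef := by
    refine real_posSemidef_iff.2
      ⟨by simp [hAs, hBs, hV.posSemidef.transpose_eq], fun x => ?_⟩
    simp only [add_mulVec, smul_mulVec, dotProduct_add, dotProduct_smul, smul_eq_mul]
    have h1 : s x * w ≤ s u * (x ⬝ᵥ V *ᵥ x) := by have := hmin x; linarith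
    have h2 : p * (x ⬝ᵥ A *ᵥ x) + q * (x ⬝ᵥ B *ᵥ x) ≤ s u * s x := by
      refine abs_le_of_sq_le_sq' ?_ (mul_nonneg hr.le (hs0 x)) |>.2
      rw [mul_pow, hru, hs2 x]
      nlinarith [sq_nonneg (p * (x ⬝ᵥ B *ᵥ x) - q * (x ⬝ᵥ A *ᵥ x))]
    nlinarith [mul_le_mul_of_nonneg_left h1 hr.le, mul_le_mul_of_nonneg_left h2 hVu.le]
  have h0 := quad_genLyap_nonneg F N hWp (u := u) (by
    simp only [add_mulVec, smul_mulVec, dotProduct_add, dotProduct_smul, smul_eq_mul, hru,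
      ← hp, ← hq, ← hw]
    ring)
  have hneg := (real_posDef_iff.1 hVL).2 u hu
  rw [genLyap_add, genLyap_add, genLyap_smul, genLyap_smul, genLyap_smul, hLA, hLB] at h0
  simp only [add_mulVec, sub_mulVec, smul_mulVec, dotProduct_add, dotProduct_sub, dotProduct_smul,
    smul_eq_mul, ← hp, ← hq, neg_mulVec, dotProduct_neg] at h0 hneg
  have h1 : 0 ≤ s u ^ 2 * (u ⬝ᵥ genLyap F N V *ᵥ u - w * z.re) := by
    rw [hru] at h0 ⊢
    linarith
  have h2 : 0 ≤ u ⬝ᵥ genLyap F N V *ᵥ u - w * z.re :=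
    nonneg_of_mul_nonneg_right h1 (by positivity)
  by_contra! h3
  nlinarith [mul_nonneg hVu.le h3]

/-- An eigenvector that need not be symmetric becomes symmetric as the off-diagonal block of the
doubled system. The determinant estimate needs this, since vectorization sees all matrices. -/
theorem IsLyapStable.re_lt_zero {F N : Matrix ι ι ℝ} (h : IsLyapStable F N)
    {X : Matrix ι ι ℂ} (hX0 : X ≠ 0) {z : ℂ}
    (hz : genLyap (F.map Complex.ofReal) (N.map Complex.ofReal) X = z • X) : z.re < 0 := by
  refine (h.fromBlocks h).re_lt_zero_of_symm (X := Matrix.fromBlocks 0 X Xᵀ 0) (z := z) ?_ ?_ ?_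
  · simp [fromBlocks_transpose]
  · intro h0
    apply hX0
    rw [← Matrix.toBlocks_fromBlocks₁₂ 0 X Xᵀ 0, h0]
    rfl
  · have hzt := congrArg transpose hz
    rw [genLyap_transpose, transpose_smul] at hzt
    have hm : (0 : Matrix ι ι ℝ).map Complex.ofReal = 0 := by ext; simp
    rw [fromBlocks_map, fromBlocks_map, hm, genLyap_fromBlocks, fromBlocks_smul]
    congr 1 <;> simp_all [genLyap]

end ComplexEigenvalues

/-! ### Uniform bounds for shifted Lyapunov solutions. -/

section UniformBound

variable {ι : Type*} [Fintype ι] [DecidableEq ι]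

/-- Matrix of `genLyap F N` in vectorized form. -/
def lyapMatrix {S : Type*} [CommRing S] (F N : Matrix ι ι S) : Matrix (ι × ι) (ι × ι) S :=
  (1 : Matrix ι ι S) ⊗ₖ Fᵀ + Fᵀ ⊗ₖ (1 : Matrix ι ι S) + Nᵀ ⊗ₖ Nᵀ

theorem lyapMatrix_mulVec_vec {S : Type*} [CommRing S] (F N X : Matrix ι ι S) :
    lyapMatrix F N *ᵥ vec X = vec (genLyap F N X) := by
  simp [lyapMatrix, genLyap, add_mulVec, kronecker_mulVec_vec, vec_add]

theorem lyapMatrix_map {α : Type*} [DecidableEq α] (F N : Matrix α α ℝ) :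
    (lyapMatrix F N).map Complex.ofReal
      = lyapMatrix (F.map Complex.ofReal) (N.map Complex.ofReal) := by
  ext ⟨i, j⟩ ⟨k, l⟩
  simp [lyapMatrix, one_apply, apply_ite Complex.ofReal]

theorem pow_card_le_norm_prod {d : ℝ} (hd : 0 ≤ d) (s : Multiset ℂ) (h : ∀ z ∈ s, d ≤ ‖z‖) :
    d ^ s.card ≤ ‖s.prod‖ := by
  induction s using Multiset.induction_on with
  | empty => simp
  | cons a s ih =>
    rw [Multiset.card_cons, Multiset.prod_cons, norm_mul, pow_succ']
    exact mul_le_mul (h a (Multiset.mem_cons_self a s))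
      (ih fun z hz => h z (Multiset.mem_cons_of_mem hz)) (by positivity) (norm_nonneg _)

/-- The eigenvalues of the shifted matrix are `d - z` with `z.re < 0`, so each has modulus at least
`d`, and the determinant is their product. -/
theorem IsLyapStable.pow_le_abs_det {F N : Matrix ι ι ℝ} (h : IsLyapStable F N) {d : ℝ}
    (hd : 0 ≤ d) :
    d ^ Fintype.card (ι × ι) ≤ |(d • (1 : Matrix (ι × ι) (ι × ι) ℝ) - lyapMatrix F N).det| := by
  set M := d • (1 : Matrix (ι × ι) (ι × ι) ℝ) - lyapMatrix F N with hM
  set Mc := M.map Complex.ofReal with hMc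
  have hMc' : Mc = (d : ℂ) • (1 : Matrix (ι × ι) (ι × ι) ℂ)
      - lyapMatrix (F.map Complex.ofReal) (N.map Complex.ofReal) := by
    rw [hMc, hM, ← lyapMatrix_map]
    ext i j
    simp [one_apply, apply_ite Complex.ofReal]
  have hdet : Mc.det = (M.det : ℂ) := by
    have := RingHom.map_det Complex.ofRealHom M
    exact this.symm
  have hroots : ∀ z ∈ Mc.charpoly.roots, d ≤ ‖z‖ := by
    intro z hz
    have hz' : Mc.charpoly.eval z = 0 := (Polynomial.mem_roots'.1 hz).2
    rw [eval_charpoly] at hz'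
    obtain ⟨v, hv0, hv⟩ := exists_mulVec_eq_zero_iff.2 hz'
    obtain ⟨X, rfl⟩ := vec_bijective.2 v
    have hX0 : X ≠ 0 := fun h0 => hv0 (by rw [h0, vec_zero])
    have hscal : scalar (ι × ι) z = z • (1 : Matrix (ι × ι) (ι × ι) ℂ) := by
      rw [scalar_apply, smul_one_eq_diagonal]
    rw [hMc', sub_mulVec, sub_mulVec, smul_mulVec, one_mulVec, lyapMatrix_mulVec_vec,
      hscal, smul_mulVec, one_mulVec, ← vec_smul, ← vec_smul, ← vec_sub,
      ← vec_sub, vec_eq_zero_iff] at hv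
    have hre := h.re_lt_zero hX0 (z := d - z) (by
      rw [sub_smul]
      rw [sub_eq_zero] at hv
      rw [hv]; abel)
    simp only [Complex.sub_re, Complex.ofReal_re] at hre
    have := Complex.re_le_norm z
    linarith
  have := pow_card_le_norm_prod hd _ hroots
  rwa [← det_eq_prod_roots_charpoly, hdet, Complex.norm_real, Real.norm_eq_abs,
    IsAlgClosed.card_roots_eq_natDegree, charpoly_natDegree_eq_dim] at this

/-- Bound, continuous in `(F, N)`, for the trace of the solution of the shifted Lyapunov equation
with right-hand side `-1`. -/
noncomputable def shiftedTraceBound (d : ℝ) (F N : Matrix ι ι ℝ) : ℝ :=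
  (∑ i, |((d • (1 : Matrix (ι × ι) (ι × ι) ℝ) - lyapMatrix F N).adjugate *ᵥ
    vec (1 : Matrix ι ι ℝ)) (i, i)|) / d ^ Fintype.card (ι × ι)

theorem continuous_shiftedTraceBound (d : ℝ) :
    Continuous fun p : Matrix ι ι ℝ × Matrix ι ι ℝ => shiftedTraceBound d p.1 p.2 := by
  have hk : Continuous fun p : Matrix ι ι ℝ × Matrix ι ι ℝ => lyapMatrix p.1 p.2 := by
    refine continuous_matrix fun i j => ?_
    simp only [lyapMatrix, Matrix.add_apply, kroneckerMap_apply, transpose_apply]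
    fun_prop
  have ha : Continuous fun p : Matrix ι ι ℝ × Matrix ι ι ℝ =>
      (d • (1 : Matrix (ι × ι) (ι × ι) ℝ) - lyapMatrix p.1 p.2).adjugate :=
    (continuous_const.sub hk).matrix_adjugate
  unfold shiftedTraceBound
  refine Continuous.div_const (continuous_finsetSum _ fun i _ => Continuous.abs ?_) _
  exact (continuous_apply (i, i)).comp (ha.matrix_mulVec continuous_const)

theorem IsLyapStable.exists_shifted_solution {F N : Matrix ι ι ℝ} (h : IsLyapStable F N) {d : ℝ}
    (hd : 0 < d) : ∃ V : Matrix ι ι ℝ, Vᵀ = V ∧ genLyap (F - (d / 2) • (1 : Matrix ι ι ℝ)) N V = -1 ∧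
      V.trace ≤ shiftedTraceBound d F N := by
  obtain ⟨V, hVs, hV⟩ := (h.sub_smul_one (a := d / 2) (by positivity)).exists_solution
    (Y := -(1 : Matrix ι ι ℝ)) (by simp)
  refine ⟨V, hVs, hV, ?_⟩
  rw [genLyap_sub_smul_one, mul_div_cancel₀ _ two_ne_zero] at hV
  set M := d • (1 : Matrix (ι × ι) (ι × ι) ℝ) - lyapMatrix F N with hM
  have h1 : M *ᵥ vec V = vec 1 := by
    rw [hM, sub_mulVec, smul_mulVec, one_mulVec, lyapMatrix_mulVec_vec, ← vec_smul, ← vec_sub,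
      ← neg_sub, hV, neg_neg]
  -- Cramer's rule: only the determinant can degenerate, and it is bounded below independently of
  -- `F` and `N`.
  have h2 : M.adjugate *ᵥ vec 1 = M.det • vec V := by
    rw [← h1, mulVec_mulVec, adjugate_mul, smul_mulVec, one_mulVec]
  have h3 := h.pow_le_abs_det hd.le
  rw [← hM] at h3
  have hpos : 0 < d ^ Fintype.card (ι × ι) := by positivity
  rw [shiftedTraceBound, ← hM, h2, le_div_iff₀ hpos, trace, Finset.sum_mul]
  refine Finset.sum_le_sum fun i _ => ?_
  simp only [Pi.smul_apply, smul_eq_mul, abs_mul, vec, diag]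
  calc V i i * d ^ Fintype.card (ι × ι) ≤ |V i i| * d ^ Fintype.card (ι × ι) := by
        gcongr; exact le_abs_self _
    _ ≤ |V i i| * |M.det| := by gcongr
    _ = _ := mul_comm _ _

end UniformBound

theorem isCompact_posSemidef_Icc {ι : Type*} [Fintype ι] (P Q : Matrix ι ι ℝ) :
    IsCompact {Z : Matrix ι ι ℝ | (Z - P).PosSemidef ∧ (Q - Z).PosSemidef} := by
  refine ((isCompact_posSemidef_trace_le (Q - P).trace).image
    (continuous_add_const P)).of_isClosed_subset ?_ ?_
  · exact (isClosed_posSemidef.preimage (continuous_id.sub continuous_const)).inter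
      (isClosed_posSemidef.preimage (continuous_const.sub continuous_id))
  · rintro Z ⟨h1, h2⟩
    refine ⟨Z - P, ⟨h1, ?_⟩, sub_add_cancel Z P⟩
    have := h2.trace_nonneg
    rw [trace_sub] at this ⊢
    rw [trace_sub]
    linarith

/-! ### Riccati residuals, comparison of solutions and the outer-loop step. -/

namespace Plant

variable {n m₁ m₂ : ℕ} (S : Plant n m₁ m₂)

/-- The forward direction uses only the absence of nonnegative real eigenvalues; the converse
controls the whole complex spectrum. -/
theorem isStable_iff {K : Matrix (Fin m₁) (Fin n) ℝ} {L : Matrix (Fin m₂) (Fin n) ℝ} :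
    S.IsStable K L ↔ IsLyapStable (S.drift K L) (S.diffusion K) := by
  constructor
  · intro h
    refine isLyapStable_of_no_nonneg_eigenvalue fun t ht X hX hE => ?_
    by_contra hX0
    have := h t ⟨X.map Complex.ofReal, by rw [← transpose_map, hX], ?_, ?_⟩
    · simp only [Complex.ofReal_re] at this
      linarith
    · intro h0
      apply hX0
      ext i j
      simpa using congrFun (congrFun h0 i) j
    · change genLyap _ _ _ = _
      have := congrArg (fun M : Matrix (Fin n) (Fin n) ℝ => M.map Complex.ofReal) hE
      refine Eq.trans (b := (genLyap (S.drift K L) (S.diffusion K) X).map Complex.ofReal) ?_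
        (this.trans ?_)
      · ext i j
        simp [genLyap, mul_apply]
      · ext i j
        simp
  · rintro h z ⟨P, hP, hP0, hz⟩
    exact h.re_lt_zero_of_symm hP hP0 hz

/-- Left-hand side of the equation for a pair of gains `K`, `L` and a candidate value `P`. -/
def residual (K : Matrix (Fin m₁) (Fin n) ℝ) (L : Matrix (Fin m₂) (Fin n) ℝ)
    (P : Matrix (Fin n) (Fin n) ℝ) : Matrix (Fin n) (Fin n) ℝ :=
  S.lyap K L P + S.Q - S.γ ^ 2 • (Lᵀ * L) + Kᵀ * S.R * K

/-- Bilinear version of `residual` in the pair of gains. -/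
def crossResidual (K₁ : Matrix (Fin m₁) (Fin n) ℝ) (L₁ : Matrix (Fin m₂) (Fin n) ℝ)
    (K₂ : Matrix (Fin m₁) (Fin n) ℝ) (L₂ : Matrix (Fin m₂) (Fin n) ℝ)
    (P : Matrix (Fin n) (Fin n) ℝ) : Matrix (Fin n) (Fin n) ℝ :=
  (S.drift K₁ L₁)ᵀ * P + P * S.drift K₂ L₂ + (S.diffusion K₁)ᵀ * P * S.diffusion K₂
    + S.Q - S.γ ^ 2 • (L₁ᵀ * L₂) + K₁ᵀ * S.R * K₂

variable {S}

theorem residual_sub (K : Matrix (Fin m₁) (Fin n) ℝ) (L : Matrix (Fin m₂) (Fin n) ℝ)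
    (P P' : Matrix (Fin n) (Fin n) ℝ) :
    S.residual K L P - S.residual K L P'
      = genLyap (S.drift K L) (S.diffusion K) (P - P') := by
  rw [genLyap_sub]
  simp only [residual, lyap, lyapunovMap, genLyap]
  abel

theorem residual_transpose (hQ : S.Qᵀ = S.Q) (hR : S.Rᵀ = S.R)
    (K : Matrix (Fin m₁) (Fin n) ℝ) (L : Matrix (Fin m₂) (Fin n) ℝ)
    {P : Matrix (Fin n) (Fin n) ℝ} (hP : Pᵀ = P) :
    (S.residual K L P)ᵀ = S.residual K L P := by
  simp only [residual, lyap, lyapunovMap, transpose_add, transpose_sub, transpose_smul,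
    transpose_mul, transpose_transpose, hP, hQ, hR, Matrix.mul_assoc]
  abel

theorem crossResidual_transpose (hQ : S.Qᵀ = S.Q) (hR : S.Rᵀ = S.R)
    (K₁ : Matrix (Fin m₁) (Fin n) ℝ) (L₁ : Matrix (Fin m₂) (Fin n) ℝ)
    (K₂ : Matrix (Fin m₁) (Fin n) ℝ) (L₂ : Matrix (Fin m₂) (Fin n) ℝ)
    {P : Matrix (Fin n) (Fin n) ℝ} (hP : Pᵀ = P) :
    (S.crossResidual K₁ L₁ K₂ L₂ P)ᵀ = S.crossResidual K₂ L₂ K₁ L₁ P := by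
  simp only [crossResidual, transpose_add, transpose_sub, transpose_smul,
    transpose_mul, transpose_transpose, hP, hQ, hR, Matrix.mul_assoc]
  abel

theorem posDef_weight (hR : S.R.PosDef) {P : Matrix (Fin n) (Fin n) ℝ} (hP : P.PosSemidef) :
    (S.R + S.Dᵀ * P * S.D).PosDef :=
  hR.add_posSemidef (posSemidef_transpose_mul_mul hP S.D)

theorem weight_mul_gainK (hR : S.R.PosDef) {P : Matrix (Fin n) (Fin n) ℝ} (hP : P.PosSemidef) :
    (S.R + S.Dᵀ * P * S.D) * S.gainK P = S.Bᵀ * P + S.Dᵀ * P * S.C :=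
  mul_nonsing_inv_cancel_left _ _ ((isUnit_iff_isUnit_det _).1 (posDef_weight hR hP).isUnit)

theorem sq_smul_gainL (hγ : 0 < S.γ) (P : Matrix (Fin n) (Fin n) ℝ) :
    S.γ ^ 2 • S.gainL P = S.Gᵀ * P := by
  rw [gainL, smul_smul, mul_one_div_cancel (by positivity), one_smul]

theorem gainK_transpose_mul_weight (hR : S.R.PosDef) {P : Matrix (Fin n) (Fin n) ℝ}
    (hP : P.PosSemidef) :
    (S.gainK P)ᵀ * (S.R + S.Dᵀ * P * S.D) = P * S.B + S.Cᵀ * P * S.D := by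
  have := congrArg transpose (weight_mul_gainK hR hP)
  rw [transpose_mul, (posDef_weight hR hP).posSemidef.transpose_eq] at this
  rw [this]
  simp only [transpose_add, transpose_mul, transpose_transpose, hP.transpose_eq, Matrix.mul_assoc]

theorem residual_eq (K : Matrix (Fin m₁) (Fin n) ℝ) (L : Matrix (Fin m₂) (Fin n) ℝ)
    (P : Matrix (Fin n) (Fin n) ℝ) :
    S.residual K L P = S.Aᵀ * P + P * S.A + S.Cᵀ * P * S.C + S.Q
      + (Lᵀ * (S.Gᵀ * P) + P * S.G * L - S.γ ^ 2 • (Lᵀ * L))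
      + (Kᵀ * ((S.R + S.Dᵀ * P * S.D) * K) - Kᵀ * (S.Bᵀ * P + S.Dᵀ * P * S.C)
        - (P * S.B + S.Cᵀ * P * S.D) * K) := by
  simp only [residual, lyap, lyapunovMap, drift, diffusion, transpose_add, transpose_sub,
    transpose_mul, Matrix.mul_add, Matrix.add_mul, Matrix.mul_sub, Matrix.sub_mul, Matrix.mul_assoc]
  abel

/-- Completion of the square in `K`: at fixed `P` and `L`, `gainK P` minimizes the residual. -/
theorem residual_eq_gainK_add (hR : S.R.PosDef) (K : Matrix (Fin m₁) (Fin n) ℝ)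
    (L : Matrix (Fin m₂) (Fin n) ℝ) {P : Matrix (Fin n) (Fin n) ℝ} (hP : P.PosSemidef) :
    S.residual K L P = S.residual (S.gainK P) L P
      + (K - S.gainK P)ᵀ * (S.R + S.Dᵀ * P * S.D) * (K - S.gainK P) := by
  have h1 := weight_mul_gainK hR hP
  have h2 := gainK_transpose_mul_weight hR hP
  rw [residual_eq, residual_eq, ← h1, ← h2]
  simp only [transpose_sub, Matrix.mul_sub, Matrix.sub_mul, Matrix.mul_assoc]
  abel

theorem residual_eq_gainL_sub (hγ : 0 < S.γ) (K : Matrix (Fin m₁) (Fin n) ℝ)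
    (L : Matrix (Fin m₂) (Fin n) ℝ) {P : Matrix (Fin n) (Fin n) ℝ} (hP : Pᵀ = P) :
    S.residual K L P = S.residual K (S.gainL P) P
      - S.γ ^ 2 • ((L - S.gainL P)ᵀ * (L - S.gainL P)) := by
  have h1 := (sq_smul_gainL hγ P).symm
  have h2 : P * S.G = S.γ ^ 2 • (S.gainL P)ᵀ := by
    have := congrArg transpose h1
    rwa [transpose_mul, transpose_transpose, hP, transpose_smul] at this
  rw [residual_eq, residual_eq, h1, h2]
  simp only [transpose_sub, Matrix.mul_sub, Matrix.sub_mul, Matrix.mul_smul, Matrix.smul_mul,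
    smul_sub]
  abel

theorem residual_gainK_le (hR : S.R.PosDef) (K : Matrix (Fin m₁) (Fin n) ℝ)
    (L : Matrix (Fin m₂) (Fin n) ℝ) {P : Matrix (Fin n) (Fin n) ℝ} (hP : P.PosSemidef) :
    (S.residual K L P - S.residual (S.gainK P) L P).PosSemidef := by
  rw [residual_eq_gainK_add hR K L hP, add_sub_cancel_left]
  exact posSemidef_transpose_mul_mul (posDef_weight hR hP).posSemidef _

theorem IsOuterSolution.residual_eq_zero {L : Matrix (Fin m₂) (Fin n) ℝ}
    {P : Matrix (Fin n) (Fin n) ℝ} (h : S.IsOuterSolution L P) :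
    S.residual (S.gainK P) L P = 0 := h.2.1

theorem IsIndefiniteSolution.residual_eq_zero (hR : S.R.PosDef) (hγ : 0 < S.γ)
    {P : Matrix (Fin n) (Fin n) ℝ} (h : S.IsIndefiniteSolution P) :
    S.residual (S.gainK P) (S.gainL P) P = 0 := by
  obtain ⟨hP, hE, -⟩ := h
  rw [residual_eq, weight_mul_gainK hR hP, sub_self, zero_sub, ← hE]
  have h2 : P * S.G = S.γ ^ 2 • (S.gainL P)ᵀ := by
    have := congrArg transpose (sq_smul_gainL hγ P).symm
    rwa [transpose_mul, transpose_transpose, hP.transpose_eq, transpose_smul] at this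
  have h3 : (1 / S.γ ^ 2) • (P * S.G * S.Gᵀ * P) = P * S.G * S.gainL P := by
    rw [gainL, Matrix.mul_smul]; simp only [Matrix.mul_assoc]
  have h4 : (S.gainL P)ᵀ * (S.Gᵀ * P) = S.γ ^ 2 • ((S.gainL P)ᵀ * S.gainL P) := by
    rw [← sq_smul_gainL hγ, Matrix.mul_smul]
  rw [h3, h4, Matrix.mul_assoc (P * S.B + S.Cᵀ * P * S.D)]
  change _ = _ - (P * S.B + S.Cᵀ * P * S.D) * S.gainK P
  abel

/-- Under the stable loop of `P'`, the gain of `P'` is suboptimal for `P`, so `P' - P` has the sign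
needed for the maximum principle. Exchanging the roles yields uniqueness. -/
theorem IsOuterSolution.sub_posSemidef (hR : S.R.PosDef) {L : Matrix (Fin m₂) (Fin n) ℝ}
    {P P' : Matrix (Fin n) (Fin n) ℝ} (h : S.IsOuterSolution L P) (h' : S.IsOuterSolution L P') :
    (P' - P).PosSemidef := by
  refine (S.isStable_iff.1 h'.2.2).posSemidef
    (by rw [transpose_sub, h.1.transpose_eq, h'.1.transpose_eq]) ?_
  rw [← residual_sub, h'.residual_eq_zero, zero_sub, neg_neg]
  have := residual_gainK_le hR (S.gainK P') L h.1
  rwa [h.residual_eq_zero, sub_zero] at this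

theorem IsOuterSolution.eq (hR : S.R.PosDef) {L : Matrix (Fin m₂) (Fin n) ℝ}
    {P P' : Matrix (Fin n) (Fin n) ℝ} (h : S.IsOuterSolution L P) (h' : S.IsOuterSolution L P') :
    P = P' := by
  refine (sub_eq_zero.1 (eq_zero_of_posSemidef_of_neg (h.sub_posSemidef hR h') ?_)).symm
  rw [neg_sub]
  exact h'.sub_posSemidef hR h

theorem IsOuterSolution.residual_gainL (hR : S.R.PosDef) (hγ : 0 < S.γ)
    {L : Matrix (Fin m₂) (Fin n) ℝ}
    {P : Matrix (Fin n) (Fin n) ℝ} (h : S.IsOuterSolution L P) (K : Matrix (Fin m₁) (Fin n) ℝ) :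
    S.residual K (S.gainL P) P
      = S.γ ^ 2 • ((L - S.gainL P)ᵀ * (L - S.gainL P))
        + (K - S.gainK P)ᵀ * (S.R + S.Dᵀ * P * S.D) * (K - S.gainK P) := by
  rw [residual_eq_gainK_add hR K _ h.1]
  have := residual_eq_gainL_sub hγ (S.gainK P) L h.1.transpose_eq
  rw [h.residual_eq_zero] at this
  rw [← sub_eq_zero.1 this.symm]

theorem IsOuterSolution.residual_gainL_posSemidef (hR : S.R.PosDef) (hγ : 0 < S.γ)
    {L : Matrix (Fin m₂) (Fin n) ℝ}
    {P : Matrix (Fin n) (Fin n) ℝ} (h : S.IsOuterSolution L P) (K : Matrix (Fin m₁) (Fin n) ℝ) :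
    (S.residual K (S.gainL P) P).PosSemidef := by
  rw [h.residual_gainL hR hγ]
  exact ((posSemidef_transpose_mul_self _).smul (by positivity)).add
    (posSemidef_transpose_mul_mul (posDef_weight hR h.1).posSemidef _)

/-- Any control gain admitting a supersolution above `P` is stabilizing for the updated
disturbance gain. -/
theorem IsOuterSolution.isLyapStable_gainL (hR : S.R.PosDef) (hγ : 0 < S.γ)
    {L : Matrix (Fin m₂) (Fin n) ℝ}
    {P Z : Matrix (Fin n) (Fin n) ℝ} (h : S.IsOuterSolution L P) {K : Matrix (Fin m₁) (Fin n) ℝ}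
    (hZ : (Z - P).PosSemidef) (hE : (-S.residual K (S.gainL P) Z).PosSemidef) :
    IsLyapStable (S.drift K (S.gainL P)) (S.diffusion K) := by
  have hW := posDef_weight hR h.1
  have heq : -genLyap (S.drift K (S.gainL P)) (S.diffusion K) (Z - P)
      = -S.residual K (S.gainL P) Z + S.residual K (S.gainL P) P := by
    rw [← residual_sub]; abel
  -- Decay of `Z - P` can vanish at `x` only if both squares do; then `K` and `gainL P` act on `x`
  -- as `gainK P` and `L`, whose loop is stable.
  refine (S.isStable_iff.1 h.2.2).of_detectable hZ ?_ fun x hx => ?_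
  · rw [heq]
    exact hE.add (h.residual_gainL_posSemidef hR hγ K)
  · rw [heq, h.residual_gainL hR hγ, add_mulVec, add_mulVec, dotProduct_add, dotProduct_add,
      smul_mulVec, dotProduct_smul, smul_eq_mul, quad_transpose_mul_mul, ← mulVec_mulVec,
      dotProduct_mulVec x (L - S.gainL P)ᵀ, vecMul_transpose] at hx
    have h1 := hE.quad_nonneg x
    have h2 := hW.posSemidef.quad_nonneg ((K - S.gainK P) *ᵥ x)
    have h3 : 0 ≤ (L - S.gainL P) *ᵥ x ⬝ᵥ (L - S.gainL P) *ᵥ x := by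
      simpa using dotProduct_star_self_nonneg ((L - S.gainL P) *ᵥ x)
    have hγ2 : 0 < S.γ ^ 2 := by positivity
    have h4 := mul_nonneg hγ2.le h3
    have h5 : (L - S.gainL P) *ᵥ x ⬝ᵥ (L - S.gainL P) *ᵥ x = 0 :=
      (mul_eq_zero.1 (by linarith : S.γ ^ 2 * _ = 0)).resolve_left hγ2.ne'
    have h6 : (K - S.gainK P) *ᵥ x = 0 := by
      by_contra h0
      have := (real_posDef_iff.1 hW).2 _ h0
      linarith
    have h7 : L *ᵥ x = S.gainL P *ᵥ x := by
      rw [dotProduct_self_eq_zero, sub_mulVec] at h5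
      exact sub_eq_zero.1 h5
    rw [sub_mulVec, sub_eq_zero] at h6
    constructor
    · simp only [drift, add_mulVec, sub_mulVec, ← mulVec_mulVec, h6, h7]
    · simp only [diffusion, sub_mulVec, ← mulVec_mulVec, h6]

theorem continuousOn_gainK (hR : S.R.PosDef) :
    ContinuousOn S.gainK {P : Matrix (Fin n) (Fin n) ℝ | P.PosSemidef} := by
  have h1 : Continuous fun P : Matrix (Fin n) (Fin n) ℝ => S.R + S.Dᵀ * P * S.D := by fun_prop
  have h2 : Continuous fun P : Matrix (Fin n) (Fin n) ℝ => S.Bᵀ * P + S.Dᵀ * P * S.C := by fun_prop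
  have h3 : ContinuousOn (fun P : Matrix (Fin n) (Fin n) ℝ => (S.R + S.Dᵀ * P * S.D)⁻¹)
      {P | P.PosSemidef} := by
    simp only [inv_def, Ring.inverse_eq_inv']
    refine ContinuousOn.smul (ContinuousOn.inv₀ h1.matrix_det.continuousOn fun P hP => ?_)
      h1.matrix_adjugate.continuousOn
    exact ((isUnit_iff_isUnit_det _).1 (posDef_weight hR hP).isUnit).ne_zero
  unfold gainK
  have hmul : Continuous fun p : Matrix (Fin m₁) (Fin m₁) ℝ × Matrix (Fin m₁) (Fin n) ℝ =>
      p.1 * p.2 := continuous_fst.matrix_mul continuous_snd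
  exact hmul.comp_continuousOn (h3.prodMk h2.continuousOn)

theorem continuousOn_residual_gainK (hR : S.R.PosDef) (L : Matrix (Fin m₂) (Fin n) ℝ) :
    ContinuousOn (fun Z => S.residual (S.gainK Z) L Z)
      {P : Matrix (Fin n) (Fin n) ℝ | P.PosSemidef} := by
  have h1 : ContinuousOn (fun Z : Matrix (Fin n) (Fin n) ℝ => (S.gainK Z, Z))
      {P : Matrix (Fin n) (Fin n) ℝ | P.PosSemidef} :=
    (continuousOn_gainK hR).prodMk continuousOn_id
  have h2 : Continuous (Function.uncurry fun (K : Matrix (Fin m₁) (Fin n) ℝ)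
      (P : Matrix (Fin n) (Fin n) ℝ) => S.residual K L P) := by
    simp only [residual, lyap, lyapunovMap, drift, diffusion, Function.uncurry_def]
    fun_prop
  have h3 := h2.comp_continuousOn h1
  simp only [Function.comp_def, Function.uncurry_apply_pair] at h3
  exact h3

/-- Solvability for the updated disturbance gain. -/
theorem IsOuterSolution.exists_next (hQ : S.Q.PosSemidef) (hR : S.R.PosDef) (hγ : 0 < S.γ)
    {Pstar : Matrix (Fin n) (Fin n) ℝ} (hPstar : S.IsIndefiniteSolution Pstar)
    {L : Matrix (Fin m₂) (Fin n) ℝ} {P : Matrix (Fin n) (Fin n) ℝ} (h : S.IsOuterSolution L P)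
    (hle : (Pstar - P).PosSemidef) :
    ∃ P', S.IsOuterSolution (S.gainL P) P' ∧ (P' - P).PosSemidef ∧ (Pstar - P').PosSemidef := by
  set L' := S.gainL P with hL'
  have hpsd : ∀ Z : Matrix (Fin n) (Fin n) ℝ, (Z - P).PosSemidef → Z.PosSemidef := fun Z hZ => by
    have := hZ.add h.1
    rwa [sub_add_cancel] at this
  let f : Matrix (Fin n) (Fin n) ℝ → Matrix (Fin n) (Fin n) ℝ :=
    fun Z => -S.residual (S.gainK Z) L' Z
  let I : Set (Matrix (Fin n) (Fin n) ℝ) := {Z | (Z - P).PosSemidef ∧ (Pstar - Z).PosSemidef}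
  have hI : IsCompact I := isCompact_posSemidef_Icc P Pstar
  have hf : ContinuousOn f I :=
    ((continuousOn_residual_gainK hR L').mono fun Z hZ => hpsd Z hZ.1).neg
  have hC : IsCompact (I ∩ f ⁻¹' {X | X.PosSemidef}) :=
    hI.of_isClosed_subset (hf.preimage_isClosed_of_isClosed hI.isClosed isClosed_posSemidef)
      Set.inter_subset_left
  have hmem : Pstar ∈ I ∩ f ⁻¹' {X | X.PosSemidef} := by
    refine ⟨⟨hle, by rw [sub_self]; exact PosSemidef.zero⟩, ?_⟩
    change (-S.residual (S.gainK Pstar) L' Pstar).PosSemidef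
    rw [residual_eq_gainL_sub hγ _ L' hPstar.1.transpose_eq, hPstar.residual_eq_zero hR hγ,
      zero_sub, neg_neg]
    exact (posSemidef_transpose_mul_self _).smul (by positivity)
  -- `Z` has least trace among the supersolutions in `[P, Pstar]`. One policy-improvement step,
  -- solving the linear equation with the gain of `Z` frozen, gives a supersolution `Y` with `P ≤ Y
  -- ≤ Z`; minimality forces `Y = Z`.
  obtain ⟨Z, ⟨⟨hZP, hZs⟩, hZf⟩, hmin⟩ :=
    hC.exists_isMinOn ⟨_, hmem⟩ (continuous_id.matrix_trace).continuousOn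
  have hZf' : (-S.residual (S.gainK Z) L' Z).PosSemidef := hZf
  have hZpsd := hpsd Z hZP
  have hstab := h.isLyapStable_gainL hR hγ hZP hZf'
  obtain ⟨Y, hYs, hY⟩ := hstab.exists_solution (Y := -S.residual (S.gainK Z) L' 0)
    (by rw [transpose_neg, residual_transpose hQ.transpose_eq hR.posSemidef.transpose_eq _ _
      transpose_zero])
  have hYres : S.residual (S.gainK Z) L' Y = 0 := by
    have := residual_sub (S := S) (S.gainK Z) L' Y 0
    rw [sub_zero, hY] at this
    rw [sub_eq_iff_eq_add.1 this, neg_add_cancel]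
  have hZY : (Z - Y).PosSemidef := by
    refine hstab.posSemidef (by rw [transpose_sub, hYs, hZpsd.transpose_eq]) ?_
    rw [← residual_sub, hYres, sub_zero]
    exact hZf'
  have hYP : (Y - P).PosSemidef := by
    refine hstab.posSemidef (by rw [transpose_sub, hYs, h.1.transpose_eq]) ?_
    rw [← residual_sub, hYres, zero_sub, neg_neg]
    exact h.residual_gainL_posSemidef hR hγ _
  have hYmem : Y ∈ I ∩ f ⁻¹' {X | X.PosSemidef} := by
    refine ⟨⟨hYP, ?_⟩, ?_⟩
    · have := hZs.add hZY
      rwa [sub_add_sub_cancel] at this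
    · have := residual_gainK_le hR (S.gainK Z) L' (hpsd Y hYP)
      rwa [hYres, zero_sub] at this
  have htr : Z.trace ≤ Y.trace := isMinOn_iff.1 hmin Y hYmem
  have hEq : Z = Y := sub_eq_zero.1
    (hZY.eq_zero_of_trace_nonpos (by rw [trace_sub]; linarith))
  rw [← hEq] at hYres
  exact ⟨Z, ⟨hZpsd, hYres, S.isStable_iff.2 hstab⟩, hZP, hZs⟩

/-- Stationarity of the residual at `gainK P` makes the left gain `K₁` drop out. The remaining term
in `L₁ - L₂` vanishes when `L₂ = gainL P`. -/
theorem crossResidual_eq (hR : S.R.PosDef) (K₁ : Matrix (Fin m₁) (Fin n) ℝ)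
    (L₁ L₂ : Matrix (Fin m₂) (Fin n) ℝ) {P : Matrix (Fin n) (Fin n) ℝ} (hP : P.PosSemidef) :
    S.crossResidual K₁ L₁ (S.gainK P) L₂ P = S.residual (S.gainK P) L₂ P
      + (L₁ - L₂)ᵀ * (S.Gᵀ * P - S.γ ^ 2 • L₂) := by
  have h1 : S.R * S.gainK P = S.Bᵀ * P + S.Dᵀ * P * S.C - S.Dᵀ * P * S.D * S.gainK P := by
    rw [← weight_mul_gainK hR hP, Matrix.add_mul, add_sub_cancel_right]
  have h2 : ∀ K : Matrix (Fin m₁) (Fin n) ℝ, Kᵀ * S.R * S.gainK P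
      = Kᵀ * (S.Bᵀ * P + S.Dᵀ * P * S.C - S.Dᵀ * P * S.D * S.gainK P) := fun K => by
    rw [Matrix.mul_assoc, h1]
  simp only [crossResidual, residual, lyap, lyapunovMap, h2]
  simp only [drift, diffusion, transpose_add, transpose_sub,
    transpose_mul, Matrix.mul_add, Matrix.add_mul, Matrix.mul_sub, Matrix.sub_mul, Matrix.mul_assoc,
    Matrix.mul_smul, smul_sub]
  abel

/-- Mixed closed-loop equation for the error after one step. -/
theorem mixed_error_equation (hQ : S.Q.PosSemidef) (hR : S.R.PosDef) (hγ : 0 < S.γ)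
    {Pstar : Matrix (Fin n) (Fin n) ℝ} (hPstar : S.IsIndefiniteSolution Pstar)
    {P P' : Matrix (Fin n) (Fin n) ℝ} (hP : Pᵀ = P) (h' : S.IsOuterSolution (S.gainL P) P') :
    (S.drift (S.gainK P') (S.gainL P))ᵀ * (Pstar - P')
      + (Pstar - P') * S.drift (S.gainK Pstar) (S.gainL Pstar)
      + (S.diffusion (S.gainK P'))ᵀ * (Pstar - P') * S.diffusion (S.gainK Pstar)
      = -((P' - P) * ((1 / S.γ ^ 2) • (S.G * S.Gᵀ)) * (Pstar - P)) := by
  have h1 : S.crossResidual (S.gainK P') (S.gainL P) (S.gainK Pstar) (S.gainL Pstar) Pstar = 0 := by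
    rw [crossResidual_eq hR _ _ _ hPstar.1, hPstar.residual_eq_zero hR hγ, sq_smul_gainL hγ,
      sub_self, Matrix.mul_zero, add_zero]
  have h2 : S.crossResidual (S.gainK P') (S.gainL P) (S.gainK Pstar) (S.gainL Pstar) P'
      = (P' - P) * ((1 / S.γ ^ 2) • (S.G * S.Gᵀ)) * (Pstar - P) := by
    rw [← crossResidual_transpose hQ.transpose_eq hR.posSemidef.transpose_eq _ _ _ _
      h'.1.transpose_eq, crossResidual_eq hR _ _ _ h'.1, h'.residual_eq_zero, zero_add,
      sq_smul_gainL hγ, ← Matrix.mul_sub, transpose_mul, transpose_mul, transpose_transpose,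
      transpose_transpose, transpose_sub, hP, h'.1.transpose_eq, gainL, gainL, ← smul_sub,
      ← Matrix.mul_sub]
    simp only [Matrix.mul_smul, Matrix.smul_mul, Matrix.mul_assoc]
  rw [← h2, ← zero_sub, ← h1]
  simp only [crossResidual, Matrix.mul_sub, Matrix.sub_mul]
  abel

end Plant

/-! ### Uniform error estimate and contraction. -/

theorem abs_mul_mul_apply_le {ι : Type*} [Fintype ι] {Y X : Matrix ι ι ℝ} (hY : Y.PosSemidef)
    (hX : X.PosSemidef) (H : Matrix ι ι ℝ) {c : ℝ} (hc : X.trace ≤ c) (i j : ι) :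
    |(Y * H * X) i j| ≤ Y.trace * ((∑ k, ∑ l, |H k l|) * c) := by
  have h0 := hY.trace_nonneg
  have h1 : (Y * H * X) i j = ∑ l, ∑ k, Y i k * H k l * X l j := by
    simp only [mul_apply, Finset.sum_mul]
  have h2 : Y.trace * ((∑ k, ∑ l, |H k l|) * c) = ∑ l, ∑ k, Y.trace * |H k l| * c := by
    rw [Finset.sum_comm]
    simp only [Finset.sum_mul, Finset.mul_sum, mul_assoc]
  rw [h1, h2]
  refine (Finset.abs_sum_le_sum_abs _ _).trans (Finset.sum_le_sum fun l _ => ?_)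
  refine (Finset.abs_sum_le_sum_abs _ _).trans (Finset.sum_le_sum fun k _ => ?_)
  rw [abs_mul, abs_mul]
  exact mul_le_mul (mul_le_mul_of_nonneg_right (hY.abs_apply_le_trace i k) (abs_nonneg _))
    ((hX.abs_apply_le_trace l j).trans hc) (abs_nonneg _) (by positivity)

namespace Plant

variable {n m₁ m₂ : ℕ} {S : Plant n m₁ m₂}

/-- The bound is continuous in the gains whether or not the loop is stable, so compactness of `[0,
Pstar]` suffices and the stable pairs need not form a closed set. -/
theorem exists_shiftedTraceBound_le (hR : S.R.PosDef) (Pstar : Matrix (Fin n) (Fin n) ℝ) (d : ℝ) :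
    ∃ b : ℝ, 0 ≤ b ∧ ∀ P P' : Matrix (Fin n) (Fin n) ℝ, P.PosSemidef → (Pstar - P).PosSemidef →
      P'.PosSemidef → (Pstar - P').PosSemidef →
      shiftedTraceBound d (S.drift (S.gainK P') (S.gainL P)) (S.diffusion (S.gainK P')) ≤ b := by
  let I : Set (Matrix (Fin n) (Fin n) ℝ) := {Z | (Z - 0).PosSemidef ∧ (Pstar - Z).PosSemidef}
  have hI : IsCompact I := isCompact_posSemidef_Icc 0 Pstar
  have hmem : ∀ Z ∈ I, Z.PosSemidef := fun Z hZ => by simpa using hZ.1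
  have h1 : ContinuousOn (fun p : Matrix (Fin n) (Fin n) ℝ × Matrix (Fin n) (Fin n) ℝ =>
      (S.gainK p.1, p.2)) (I ×ˢ I) :=
    (((continuousOn_gainK hR).mono hmem).comp continuousOn_fst fun p hp => hp.1).prodMk
      continuousOn_snd
  have h2 : Continuous fun p : Matrix (Fin m₁) (Fin n) ℝ × Matrix (Fin n) (Fin n) ℝ =>
      (S.drift p.1 (S.gainL p.2), S.diffusion p.1) := by
    unfold drift diffusion gainL
    fun_prop
  have h3 := ((continuous_shiftedTraceBound d).comp h2).comp_continuousOn h1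
  obtain ⟨b, hb⟩ := (hI.prod hI).exists_bound_of_continuousOn h3
  refine ⟨max b 0, le_max_right _ _, fun P P' hP hPs hP' hPs' => ?_⟩
  have h4 := hb (P', P) ⟨⟨by simpa using hP', hPs'⟩, ⟨by simpa using hP, hPs⟩⟩
  exact ((le_abs_self _).trans h4).trans (le_max_left _ _)

/-- Uniform one-step error estimate. -/
theorem exists_error_bound (hQ : S.Q.PosSemidef) (hR : S.R.PosDef) (hγ : 0 < S.γ)
    {Pstar : Matrix (Fin n) (Fin n) ℝ} (hPstar : S.IsIndefiniteSolution Pstar) :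
    ∃ c : ℝ, 0 ≤ c ∧ ∀ P P' : Matrix (Fin n) (Fin n) ℝ, P.PosSemidef → (P' - P).PosSemidef →
      (Pstar - P').PosSemidef → S.IsOuterSolution (S.gainL P) P' →
        (Pstar - P').trace ≤ c * (P' - P).trace := by
  obtain ⟨a, ha, hstar⟩ := (S.isStable_iff.1 hPstar.2.2).exists_add_smul_one
  obtain ⟨W, hWs, hW⟩ := hstar.exists_solution (Y := -(1 : Matrix (Fin n) (Fin n) ℝ)) (by simp)
  obtain ⟨b, hb, hbound⟩ := exists_shiftedTraceBound_le hR Pstar (2 * a)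
  set H : Matrix (Fin n) (Fin n) ℝ := (1 / S.γ ^ 2) • (S.G * S.Gᵀ)
  set η : ℝ := (∑ k, ∑ l, |H k l|) * Pstar.trace
  have hη : 0 ≤ η := mul_nonneg (by positivity) hPstar.1.trace_nonneg
  -- The source entries are at most `η` times the trace of `P' - P`; `b` bounds the left Lyapunov
  -- solution and `|W.trace|` the right one.
  refine ⟨n * η * (b + |W.trace|) / 2, by positivity, fun P P' hP hPP' hP's h' => ?_⟩
  have hPs : (Pstar - P).PosSemidef := by
    have := hP's.add hPP'
    rwa [sub_add_sub_cancel] at this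
  have hstab := S.isStable_iff.1 h'.2.2
  obtain ⟨V, hVs, hV, hVtr⟩ := hstab.exists_shifted_solution (d := 2 * a) (by positivity)
  rw [mul_div_cancel_left₀ _ two_ne_zero] at hV
  have hVb := hVtr.trans (hbound P P' hP hPs h'.1 hP's)
  have htrP : (Pstar - P).trace ≤ Pstar.trace := by
    have := hP.trace_nonneg
    rw [trace_sub]; linarith
  -- The shifts by `-a` and `+a` cancel in the mixed operator.
  have hmix : (S.drift (S.gainK P') (S.gainL P) - a • (1 : Matrix (Fin n) (Fin n) ℝ))ᵀ
      * (Pstar - P') + (Pstar - P') * (S.drift (S.gainK Pstar) (S.gainL Pstar)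
        + a • (1 : Matrix (Fin n) (Fin n) ℝ))
      + (S.diffusion (S.gainK P'))ᵀ * (Pstar - P') * S.diffusion (S.gainK Pstar)
      = -((P' - P) * H * (Pstar - P)) := by
    rw [← mixed_error_equation hQ hR hγ hPstar hP.transpose_eq h', transpose_sub, transpose_smul,
      transpose_one, Matrix.sub_mul, Matrix.mul_add, Matrix.smul_mul, Matrix.one_mul,
      Matrix.mul_smul, Matrix.mul_one]
    abel
  have key := two_mul_trace_le_of_mixed (hstab.sub_smul_one ha.le) hstar hVs hWs hV hW hmix
    (abs_mul_mul_apply_le hPP' hPs H htrP)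
  rw [Fintype.card_fin] at key
  have h0 : 0 ≤ n * ((P' - P).trace * η) :=
    mul_nonneg (Nat.cast_nonneg n) (mul_nonneg hPP'.trace_nonneg hη)
  have h1 := mul_le_mul_of_nonneg_left (add_le_add hVb (le_abs_self W.trace)) h0
  linarith

theorem exists_of_mem_gainSublevel {Pstar : Matrix (Fin n) (Fin n) ℝ} {ζ : ℝ} (hR : S.R.PosDef)
    {L : Matrix (Fin m₂) (Fin n) ℝ} (hL : L ∈ S.gainSublevel Pstar ζ)
    {P : Matrix (Fin n) (Fin n) ℝ} (hP : S.IsOuterSolution L P) :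
    (Pstar - P).PosSemidef ∧ (Pstar - P).trace ≤ ζ := by
  obtain ⟨-, P₁, h1, h2⟩ := hL
  rwa [hP.eq hR h1]

theorem gainL_mem_gainSublevel (hQ : S.Q.PosSemidef) (hR : S.R.PosDef) (hγ : 0 < S.γ)
    {Pstar : Matrix (Fin n) (Fin n) ℝ} (hPstar : S.IsIndefiniteSolution Pstar) {ζ : ℝ}
    {L : Matrix (Fin m₂) (Fin n) ℝ} (hL : L ∈ S.gainSublevel Pstar ζ)
    {P : Matrix (Fin n) (Fin n) ℝ} (hP : S.IsOuterSolution L P) :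
    S.gainL P ∈ S.gainSublevel Pstar ζ := by
  obtain ⟨hle, htr⟩ := exists_of_mem_gainSublevel hR hL hP
  obtain ⟨P', h', hPP', hle'⟩ := hP.exists_next hQ hR hγ hPstar hle
  refine ⟨⟨P', ⟨h', hle'⟩, fun Z hZ => hZ.1.eq hR h'⟩, P', h', hle', ?_⟩
  have := hPP'.trace_nonneg
  rw [trace_sub] at this htr ⊢
  linarith

theorem exists_contraction (hQ : S.Q.PosSemidef) (hR : S.R.PosDef) (hγ : 0 < S.γ)
    {Pstar : Matrix (Fin n) (Fin n) ℝ} (hPstar : S.IsIndefiniteSolution Pstar) :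
    ∃ α : ℝ, 0 < α ∧ α < 1 ∧ ∀ ζ : ℝ, ∀ L ∈ S.gainSublevel Pstar ζ,
      ∀ P P' : Matrix (Fin n) (Fin n) ℝ, S.IsOuterSolution L P →
        S.IsOuterSolution (S.gainL P) P' → (Pstar - P').trace ≤ α * (Pstar - P).trace := by
  obtain ⟨c, hc, hbound⟩ := exists_error_bound hQ hR hγ hPstar
  -- The estimate itself gives the factor `c / (c + 1)`; replacing `c` by `c + 1` keeps it positive
  -- when `c = 0`.
  refine ⟨(c + 1) / (c + 2), by positivity, by rw [div_lt_one (by positivity)]; linarith,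
    fun ζ L hL P P' hP hP' => ?_⟩
  obtain ⟨hle, -⟩ := exists_of_mem_gainSublevel hR hL hP
  obtain ⟨Z, hZ, hPZ, hZs⟩ := hP.exists_next hQ hR hγ hPstar hle
  obtain rfl := hP'.eq hR hZ
  have h1 := hbound P P' hP.1 hPZ hZs hP'
  have h2 := hPZ.trace_nonneg
  rw [div_mul_eq_mul_div, le_div_iff₀ (by positivity)]
  rw [trace_sub] at h1 h2 ⊢
  rw [trace_sub] at h1 ⊢
  linarith

end Plant

theorem theorem3 {n m₁ m₂ : ℕ} (S : Plant n m₁ m₂)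
    (hQ : S.Q.PosSemidef) (hR : S.R.PosDef) (hγ : 0 < S.γ)
    (Pstar : Matrix (Fin n) (Fin n) ℝ) (hPstar : S.IsIndefiniteSolution Pstar)
    (ζ : ℝ) (hζ : 0 < ζ) :
    ∃ α : ℝ, 0 < α ∧ α < 1 ∧
      -- the outer-loop step is well defined on the sublevel set and stays in it
      (∀ L ∈ S.gainSublevel Pstar ζ, (∃! P, S.IsOuterSolution L P) ∧
        ∀ P, S.IsOuterSolution L P → S.gainL P ∈ S.gainSublevel Pstar ζ) ∧
      -- contraction: `L`, `P`, `gainL P`, `P'` are `L^{k-1}`, `P^k`, `L^k`, `P^{k+1}`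
      (∀ L ∈ S.gainSublevel Pstar ζ, ∀ P P' : Matrix (Fin n) (Fin n) ℝ,
        S.IsOuterSolution L P → S.IsOuterSolution (S.gainL P) P' →
          (Pstar - P').trace ≤ α * (Pstar - P).trace) ∧
      -- linear convergence of the outer loop
      (∀ (P : ℕ → Matrix (Fin n) (Fin n) ℝ) (L : ℕ → Matrix (Fin m₂) (Fin n) ℝ),
        S.IsOuterLoop P L → L 0 ∈ S.gainSublevel Pstar ζ →
          ∀ k : ℕ, 1 ≤ k → (Pstar - P k).trace ≤ α ^ (k - 1) * (Pstar - P 1).trace) := by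
  obtain ⟨α, h0, h1, hα⟩ := Plant.exists_contraction hQ hR hγ hPstar
  refine ⟨α, h0, h1, fun L hL => ⟨?_, fun P hP => ?_⟩, hα ζ, fun P L hPL hL0 => ?_⟩
  · obtain ⟨-, P, hP, -⟩ := id hL
    exact ⟨P, hP, fun Z hZ => hZ.eq hR hP⟩
  · exact Plant.gainL_mem_gainSublevel hQ hR hγ hPstar hL hP
  · have hsol : ∀ k, S.IsOuterSolution (L k) (P (k + 1)) := fun k => (hPL (k + 1) k.succ_pos).1
    have hgain : ∀ k, L (k + 1) = S.gainL (P (k + 1)) := fun k => (hPL (k + 1) k.succ_pos).2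
    have hmem : ∀ k, L k ∈ S.gainSublevel Pstar ζ := by
      intro k
      induction k with
      | zero => exact hL0
      | succ k ih =>
        rw [hgain]
        exact Plant.gainL_mem_gainSublevel hQ hR hγ hPstar ih (hsol k)
    intro k hk
    obtain ⟨k, rfl⟩ := Nat.exists_eq_add_of_le' hk
    rw [Nat.add_sub_cancel]
    induction k with
    | zero => simp
    | succ k ih =>
      have h2 := hα ζ (L k) (hmem k) _ (P (k + 2)) (hsol k) (by rw [← hgain]; exact hsol (k + 1))
      rw [pow_succ', mul_assoc]
      exact h2.trans (mul_le_mul_of_nonneg_left (ih (by omega)) h0.le)
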